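/- Let $n\ge 2$, let $\mathcal I\subseteq(0,\infty)$ be an open interval, let $f:\mathcal I\to(0,\infty)$ be smooth, and let $\mathbb R\times M^n$, $M^n=\mathcal I\times\mathbb S^{n-1}$, carry the Lorentzian metric $$\mathfrak g=-f(r)\,dt^2+\frac1{f(r)}\,dr^2+r^2\,\Omega ,$$ where $\Omega$ is the canonical metric of $\mathbb S^{n-1}$ (a spacetime of class $\mathcal S$). *Definitions.* A subset $H\subseteq\mathbb R\times M^n$ is *spherically symmetric* if every non-empty slice $H\cap\{t=t_0\}$ is a full sphere $\{t_0\}\times\{r_0\}\times\mathbb S^{n-1}$ with $r_0\in\mathcal I$. A *null geodesic* is a geodesic $\zeta=(t,r,\xi):J\to\mathbb R\times M^n$ on a non-empty open interval $J\subseteq\mathbb R$ with $\dot\zeta\neq0$ and $\mathfrak g(\dot\zeta,\dot\zeta)=0$; it is *maximal* if it does not extend, as a geodesic, to a strictly larger open interval. Its energy is $E=-\mathfrak g(\partial_t,\dot\zeta)$ and its angular momentum is $\ell=(\Omega^{KL}\ell_K\ell_L)^{1/2}=r^2|\dot\xi|_\Omega$, where $\ell_K=\mathfrak g(X_K,\dot\zeta)$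 for linearly independent rotational Killing fields $X_1,\dots,X_{n-1}$ and $(\Omega^{KL})$ is the inverse of the matrix $(\Omega(X_K,X_L))$. It *generates* $H$ if $H=H_\zeta:=\{(t(s),r(s),\xi_*) : s\in J,\ \xi_*\in\mathbb S^{n-1}\}$. A *photon surface* is a timelike (i.e. with Lorentzian induced metric) smooth embedded hypersurface that is null totally geodesic: every null geodesic tangent to it at some parameter stays in it, and tangent to it, for all nearby parameters. A connected, spherically symmetric photon surface is *maximal* if it is not contained in a strictly larger connected, spherically symmetric photon surface. *Proposition.* Let $H^n$ be a connected, spherically symmetric, timelike, smooth embedded hypersurface of $\mathbb R\times M^n$. 1. $H^n$ is generated by a null geodesic if and only if it is a photon surface. 2. $H^n$ is a maximal photon surface if and only if it is generated by a null geodesic and every null geodesic generating $H^n$ is maximal. Equivalently, some null geodesic generating $H^n$ is maximal. 3. Along every null geodesic $\zeta$ generating $H^n$, the energy $E$ and the angular momentum $\ell$ are constant, $\ell>0$, and $H^n$ is totally umbilic: its second fundamental form $\mathfrak h(X,Y)=\mathfrak g(\nabla_X\eta,Y)$ with respect to the outward unit normal $\eta$ ($dr(\eta)>0$) is $\mathfrak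 h=\lambda\,p$, where $p$ is the induced metric and the umbilicity factor is the constant $\lambda=|E|/\ell$. In particular $\lambda=E/\ell$ if $\zeta$ is future-directed ($\dot t>0$). -/

import Mathlib

open scoped ContDiff Topology InnerProductSpace

noncomputable section

namespace PhotonSurfaces

/-! ## Metrics on open subsets of a vector space -/

section General

variable {V : Type*} [NormedAddCommGroup V] [NormedSpace ℝ V]

/-- `christoffel g p u v z` is `g(∇_u v, z)` at `p`, where `u`, `v`, `z` are extended to constant
vector fields and `∇` is the Levi-Civita connection of the metric `g` (Koszul formula):
these are the Christoffel symbols of the first kind in the global linear coordinates of `V`. -/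
def christoffel (g : V → V →L[ℝ] V →L[ℝ] ℝ) (p u v z : V) : ℝ :=
  (1 / 2) * (fderiv ℝ g p u v z + fderiv ℝ g p v u z - fderiv ℝ g p z u v)

/-- `covDerivPairing g Y p u z` is `g(∇_u Y, z)` at `p`, for a vector field `Y` defined near `p`
and vectors `u`, `z` at `p`. -/
def covDerivPairing (g : V → V →L[ℝ] V →L[ℝ] ℝ) (Y : V → V) (p u z : V) : ℝ :=
  g p (fderiv ℝ Y p u) z + christoffel g p u (Y p) z

/-- The curve `ζ`, restricted to the non-empty open interval `J`, is a geodesic of the metric `g`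
in the open set `U`: `g(∇_{ζ'} ζ', z) = 0` along `ζ` for all vectors `z`.
(The values of `ζ` outside `J` play no role.) -/
structure IsGeodesic (g : V → V →L[ℝ] V →L[ℝ] ℝ) (U : Set V) (ζ : ℝ → V) (J : Set ℝ) : Prop where
  isOpen : IsOpen J
  ordConnected : J.OrdConnected
  nonempty : J.Nonempty
  smooth : ContDiffOn ℝ ∞ ζ J
  mapsTo : Set.MapsTo ζ J U
  eqn : ∀ s ∈ J, ∀ z : V,
    g (ζ s) (deriv (deriv ζ) s) z + christoffel g (ζ s) (deriv ζ s) (deriv ζ s) z = 0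

/-- A null geodesic: a geodesic whose velocity is a non-zero null vector at every parameter. -/
structure IsNullGeodesic (g : V → V →L[ℝ] V →L[ℝ] ℝ) (U : Set V) (ζ : ℝ → V) (J : Set ℝ) :
    Prop where
  isGeodesic : IsGeodesic g U ζ J
  null : ∀ s ∈ J, g (ζ s) (deriv ζ s) (deriv ζ s) = 0
  ne_zero : ∀ s ∈ J, deriv ζ s ≠ 0

/-- The geodesic `ζ` on `J` is maximal: it cannot be extended, as a geodesic in `U`, to a
strictly larger open interval. -/
def IsMaximalGeodesic (g : V → V →L[ℝ] V →L[ℝ] ℝ) (U : Set V) (ζ : ℝ → V) (J : Set ℝ) : Prop :=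
  IsGeodesic g U ζ J ∧
    ∀ (ζ' : ℝ → V) (J' : Set ℝ), IsGeodesic g U ζ' J' → J ⊆ J' → Set.EqOn ζ ζ' J → J' = J

/-- A smooth embedded hypersurface of the open set `U`: near each of its points it is the zero set
of a smooth function with non-vanishing differential. -/
def IsHypersurface (U H : Set V) : Prop :=
  H ⊆ U ∧ ∀ p ∈ H, ∃ (W : Set V) (F : V → ℝ), IsOpen W ∧ p ∈ W ∧ ContDiffOn ℝ ∞ F W ∧
    (∀ q ∈ W, fderiv ℝ F q ≠ 0) ∧ ∀ q ∈ W, q ∈ H ↔ F q = 0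

/-- The tangent space of the hypersurface `H` at `p`: all velocities at `p` of curves in `H`
through `p`. (For an embedded hypersurface it makes no difference whether the curves are smooth or
merely differentiable at `p`: in both cases one obtains the kernel of the differential at `p` of a
local defining function.) -/
def tangentSet (H : Set V) (p : V) : Set V :=
  {v | ∃ c : ℝ → V, c 0 = p ∧ HasDerivAt c v 0 ∧ ∀ᶠ s in 𝓝 (0 : ℝ), c s ∈ H}

/-- `H` is timelike: the metric induced on each of its tangent spaces is Lorentzian, that is,
there is a tangent vector `v` with `g(v, v) < 0` on whose orthogonal complement in the tangent
space the metric is positive definite. -/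
def IsTimelike (g : V → V →L[ℝ] V →L[ℝ] ℝ) (H : Set V) : Prop :=
  ∀ p ∈ H, ∃ v ∈ tangentSet H p, g p v v < 0 ∧
    ∀ w ∈ tangentSet H p, g p v w = 0 → w ≠ 0 → 0 < g p w w

/-- `H` is null totally geodesic: a null geodesic of the ambient space that is tangent to `H` at
some parameter `s₀` remains in `H` and tangent to `H` for all parameters near `s₀`. -/
def IsNullTotallyGeodesic (g : V → V →L[ℝ] V →L[ℝ] ℝ) (U H : Set V) : Prop :=
  ∀ (ζ : ℝ → V) (J : Set ℝ), IsNullGeodesic g U ζ J →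
    ∀ s₀ ∈ J, ζ s₀ ∈ H → deriv ζ s₀ ∈ tangentSet H (ζ s₀) →
      ∀ᶠ s in 𝓝 s₀, ζ s ∈ H ∧ deriv ζ s ∈ tangentSet H (ζ s)

/-- A photon surface: a timelike, embedded, null totally geodesic hypersurface. -/
structure IsPhotonSurface (g : V → V →L[ℝ] V →L[ℝ] ℝ) (U P : Set V) : Prop where
  hypersurface : IsHypersurface U P
  timelike : IsTimelike g P
  nullTotallyGeodesic : IsNullTotallyGeodesic g U P

end General

/-! ## Spacetimes of class `𝒮` -/

/-- The Cartesian model `ℝ × ℝⁿ`, in which the point `(t, r, ξ) ∈ ℝ × (0, ∞) × 𝕊ⁿ⁻¹` is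
represented by `(t, r ξ)`. -/
abbrev Pt (n : ℕ) : Type := ℝ × EuclideanSpace ℝ (Fin n)

/-- The coordinate `t`. -/
def timeCoord {n : ℕ} (p : Pt n) : ℝ := p.1

/-- The coordinate `r`. -/
def radius {n : ℕ} (p : Pt n) : ℝ := ‖p.2‖

/-- The coordinate `ξ ∈ 𝕊ⁿ⁻¹`. -/
def angle {n : ℕ} (p : Pt n) : EuclideanSpace ℝ (Fin n) := ‖p.2‖⁻¹ • p.2

/-- The differential `dt`. -/
def dt (n : ℕ) : Pt n →L[ℝ] ℝ := ContinuousLinearMap.fst ℝ ℝ (EuclideanSpace ℝ (Fin n))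

/-- The differential `dr` at `p`; see `hasFDerivAt_radius`. -/
def dr {n : ℕ} (p : Pt n) : Pt n →L[ℝ] ℝ :=
  (innerSL ℝ (angle p)).comp (ContinuousLinearMap.snd ℝ ℝ (EuclideanSpace ℝ (Fin n)))

/-- The differential `dξ` at `p`, with values in `T_ξ 𝕊ⁿ⁻¹ = ξ^⊥ ⊆ ℝⁿ`;
see `hasFDerivAt_angle`. -/
def dξ {n : ℕ} (p : Pt n) : Pt n →L[ℝ] EuclideanSpace ℝ (Fin n) :=
  (radius p)⁻¹ • (ContinuousLinearMap.snd ℝ ℝ (EuclideanSpace ℝ (Fin n))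
    - (dr p).smulRight (angle p))

theorem hasFDerivAt_radius {n : ℕ} (p : Pt n) (hp : p.2 ≠ 0) :
    HasFDerivAt (radius (n := n)) (dr p) p := by
  have h1 : HasFDerivAt (fun q : Pt n => √(‖q.2‖ ^ 2)) _ p :=
    ((hasFDerivAt_snd (𝕜 := ℝ) (p := p)).norm_sq).sqrt (by simpa using hp)
  have h2 : (fun q : Pt n => √(‖q.2‖ ^ 2)) = radius := by
    funext q; simp [radius, Real.sqrt_sq (norm_nonneg _)]
  rw [h2] at h1
  refine h1.congr_fderiv (ContinuousLinearMap.ext fun v => ?_)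
  simp [dr, angle, Real.sqrt_sq (norm_nonneg _)]
  field_simp

theorem hasFDerivAt_angle {n : ℕ} (p : Pt n) (hp : p.2 ≠ 0) :
    HasFDerivAt (angle (n := n)) (dξ p) p := by
  have hr : radius p ≠ 0 := by simpa [radius] using hp
  have h1 := ((hasDerivAt_inv hr).comp_hasFDerivAt p (hasFDerivAt_radius p hp)).smul
      (hasFDerivAt_snd (𝕜 := ℝ) (p := p))
  refine HasFDerivAt.congr_fderiv (f := angle (n := n)) h1 (ContinuousLinearMap.ext fun v => ?_)
  simp only [dξ, angle, radius, smul_apply, sub_apply,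
    add_apply, ContinuousLinearMap.smulRight_apply,
    ContinuousLinearMap.coe_snd', smul_sub, smul_smul, Function.comp] at hr ⊢
  rw [sub_eq_add_neg, ← neg_smul]
  congr 2
  simp only [smul_eq_mul]
  field_simp

/-- The vector field `∂_t`. -/
def partialT (n : ℕ) : Pt n := (1, 0)

/-- The data of a spacetime of class `𝒮`: an open interval `I ⊆ (0, ∞)` and a smooth, positive
function `f` on `I`. -/
structure ClassS where
  I : Set ℝ
  isOpen : IsOpen I
  ordConnected : I.OrdConnected
  pos : I ⊆ Set.Ioi 0
  f : ℝ → ℝ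
  smooth : ContDiffOn ℝ ∞ f I
  f_pos : ∀ r ∈ I, 0 < f r

namespace ClassS

/-- The spacetime manifold `ℝ × I × 𝕊ⁿ⁻¹`. -/
def carrier (S : ClassS) (n : ℕ) : Set (Pt n) := {p | radius p ∈ S.I}

/-- The pullback to the spacetime of the canonical metric of `𝕊ⁿ⁻¹`:
`Ω(u, v) = ⟨dξ u, dξ v⟩`. -/
def sphereMetric {n : ℕ} (p : Pt n) : Pt n →L[ℝ] Pt n →L[ℝ] ℝ :=
  (innerSL ℝ (E := EuclideanSpace ℝ (Fin n))).bilinearComp (dξ p) (dξ p)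

/-- The spacetime metric `-f(r) dt² + f(r)⁻¹ dr² + r² Ω`. -/
def metric (S : ClassS) (n : ℕ) (p : Pt n) : Pt n →L[ℝ] Pt n →L[ℝ] ℝ :=
  -(S.f (radius p)) • (dt n).smulRight (dt n)
    + (1 / S.f (radius p)) • (dr p).smulRight (dr p)
    + (radius p) ^ 2 • sphereMetric p

theorem metric_apply (S : ClassS) (n : ℕ) (p u v : Pt n) :
    S.metric n p u v = -S.f (radius p) * (u.1 * v.1)
      + 1 / S.f (radius p) * (dr p u * dr p v)
      + (radius p) ^ 2 * ⟪dξ p u, dξ p v⟫_ℝ := by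
  simp [metric, sphereMetric, dt, ContinuousLinearMap.bilinearComp]

/-- A subset `H` of the spacetime is spherically symmetric if each non-empty time-slice
`H ∩ {t = t₀}` is a full sphere `{t₀} × {r₀} × 𝕊ⁿ⁻¹`. -/
def IsSphericallySymmetric (S : ClassS) {n : ℕ} (H : Set (Pt n)) : Prop :=
  ∀ t₀ : ℝ, (∃ p ∈ H, timeCoord p = t₀) → ∃ r₀ ∈ S.I,
    {p ∈ H | timeCoord p = t₀} =
      {p | timeCoord p = t₀ ∧ ∃ ξ ∈ Metric.sphere (0 : EuclideanSpace ℝ (Fin n)) 1, p.2 = r₀ • ξ}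

/-- Connected, spherically symmetric photon surfaces. -/
structure IsSymmetricPhotonSurface (S : ClassS) {n : ℕ} (P : Set (Pt n)) : Prop where
  isPhotonSurface : IsPhotonSurface (S.metric n) (S.carrier n) P
  isConnected : IsConnected P
  sphericallySymmetric : S.IsSphericallySymmetric P

/-- Maximal photon surfaces: connected, spherically symmetric photon surfaces which do not lie
inside a strictly larger connected, spherically symmetric photon surface. -/
def IsMaximalPhotonSurface (S : ClassS) {n : ℕ} (P : Set (Pt n)) : Prop :=
  S.IsSymmetricPhotonSurface P ∧
    ∀ Q : Set (Pt n), S.IsSymmetricPhotonSurface Q → P ⊆ Q → Q = P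

/-- The set `H_ζ` swept out by rotating the curve `ζ`, restricted to `J`, around `𝕊ⁿ⁻¹`. -/
def orbit {n : ℕ} (ζ : ℝ → Pt n) (J : Set ℝ) : Set (Pt n) :=
  {p | ∃ s ∈ J, ∃ ξ ∈ Metric.sphere (0 : EuclideanSpace ℝ (Fin n)) 1,
    timeCoord p = timeCoord (ζ s) ∧ p.2 = radius (ζ s) • ξ}

/-- `H` is generated by the null geodesic `ζ : J → ℝ × M`. -/
def Generates (S : ClassS) {n : ℕ} (ζ : ℝ → Pt n) (J : Set ℝ) (H : Set (Pt n)) : Prop :=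
  IsNullGeodesic (S.metric n) (S.carrier n) ζ J ∧ H = orbit ζ J

/-- The energy `-g(∂_t, ζ')` of the curve `ζ` at the parameter `s`. -/
def energy (S : ClassS) {n : ℕ} (ζ : ℝ → Pt n) (s : ℝ) : ℝ :=
  -S.metric n (ζ s) (partialT n) (deriv ζ s)

/-- The total angular momentum `r² |ξ'|_Ω` of the curve `ζ` at the parameter `s`. It is expressed
through the rotational Killing fields in `angularMomentum_eq`. -/
def angularMomentum {n : ℕ} (ζ : ℝ → Pt n) (s : ℝ) : ℝ :=
  (radius (ζ s)) ^ 2 * ‖dξ (ζ s) (deriv ζ s)‖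

/-- The rotational Killing vector field generated by a (skew-adjoint) linear map `A`. -/
def rotationField {n : ℕ} (A : EuclideanSpace ℝ (Fin n) →ₗ[ℝ] EuclideanSpace ℝ (Fin n))
    (p : Pt n) : Pt n := (0, A p.2)

/-- For rotational Killing fields `X_K`, `K = 1, …, n - 1`, that are linearly independent at
the point `ζ s`, the angular momentum is `(Ω^{KL} ℓ_K ℓ_L)^{1/2}`, where `ℓ_K = g(X_K, ζ')` and
`(Ω^{KL})` is the inverse of the matrix `(Ω(X_K, X_L))`. -/
theorem angularMomentum_eq (S : ClassS) {n : ℕ} (hn : 1 ≤ n) (ζ : ℝ → Pt n) (s : ℝ)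
    (hζ : ζ s ∈ S.carrier n)
    (A : Fin (n - 1) → EuclideanSpace ℝ (Fin n) →ₗ[ℝ] EuclideanSpace ℝ (Fin n))
    (hA : ∀ K x y, ⟪A K x, y⟫_ℝ = -⟪x, A K y⟫_ℝ)
    (hind : LinearIndependent ℝ fun K => rotationField (A K) (ζ s)) :
    angularMomentum ζ s =
      √(∑ K, ∑ L, (Matrix.of fun K L => sphereMetric (ζ s) (rotationField (A K) (ζ s))
            (rotationField (A L) (ζ s)))⁻¹ K L
          * S.metric n (ζ s) (rotationField (A K) (ζ s)) (deriv ζ s)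
          * S.metric n (ζ s) (rotationField (A L) (ζ s)) (deriv ζ s)) := by
  obtain ⟨p, hp⟩ : ∃ p, p = ζ s := ⟨_, rfl⟩
  obtain ⟨v, hv⟩ : ∃ v, v = deriv ζ s := ⟨_, rfl⟩
  simp only [angularMomentum, ← hp, ← hv] at hζ hind ⊢
  have hr : 0 < radius p := S.pos hζ
  have hp2 : p.2 ≠ 0 := by
    intro h; simp [radius, h] at hr
  have hangle : ‖angle p‖ = 1 := by simp [angle, norm_smul, hp2]
  have hAx (K) : ⟪p.2, A K p.2⟫_ℝ = 0 := by
    have := hA K p.2 p.2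
    rw [real_inner_comm] at this
    linarith
  have hdr (K) : dr p (rotationField (A K) p) = 0 := by
    simp [dr, rotationField, angle, hAx]
  have hdξ (K) : dξ p (rotationField (A K) p) = (radius p)⁻¹ • A K p.2 := by
    simp [dξ, hdr]
    simp [rotationField]
  obtain ⟨w, hw⟩ : ∃ w : Fin (n - 1) → EuclideanSpace ℝ (Fin n),
      w = fun K => dξ p (rotationField (A K) p) := ⟨_, rfl⟩
  have hwK (K) : dξ p (rotationField (A K) p) = w K := by rw [hw]
  have hwind : LinearIndependent ℝ w := by
    have h1 : LinearIndependent ℝ fun K => A K p.2 := by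
      have := hind
      refine LinearIndependent.of_comp
        (LinearMap.inr ℝ ℝ (EuclideanSpace ℝ (Fin n))) ?_
      exact this
    have h2 := h1.units_smul fun _ => Units.mk0 (radius p)⁻¹ (inv_ne_zero hr.ne')
    rw [hw]
    convert h2 using 1
    funext K
    rw [hdξ]; rfl
  obtain ⟨y, hy⟩ : ∃ y, y = dξ p v := ⟨_, rfl⟩
  have hyperp : ⟪p.2, y⟫_ℝ = 0 := by
    have hself : ⟪p.2, angle p⟫_ℝ = radius p := by
      simp only [angle, real_inner_smul_right, real_inner_self_eq_norm_sq, radius]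
      have : ‖p.2‖ ≠ 0 := by simpa using hp2
      field_simp
    have hdrv : dr p v = (radius p)⁻¹ * ⟪p.2, v.2⟫_ℝ := by
      simp [dr, angle, radius]
    rw [hy]
    simp only [dξ, smul_apply, sub_apply,
      ContinuousLinearMap.smulRight_apply, ContinuousLinearMap.coe_snd', real_inner_smul_right,
      inner_sub_right, hself, hdrv]
    field_simp
    ring
  have hspan : y ∈ Submodule.span ℝ (Set.range w) := by
    have hle : Submodule.span ℝ (Set.range w) ≤ (ℝ ∙ p.2)ᗮ := by
      rw [Submodule.span_le]
      rintro _ ⟨K, rfl⟩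
      rw [SetLike.mem_coe, Submodule.mem_orthogonal_singleton_iff_inner_right, ← hwK, hdξ,
        real_inner_smul_right, hAx, mul_zero]
    have hfin : Module.finrank ℝ (EuclideanSpace ℝ (Fin n)) = (n - 1) + 1 := by
      rw [finrank_euclideanSpace_fin]; omega
    have : Fact (Module.finrank ℝ (EuclideanSpace ℝ (Fin n)) = (n - 1) + 1) := ⟨hfin⟩
    have heq := Submodule.eq_of_le_of_finrank_eq hle (by
      rw [finrank_span_eq_card hwind, Submodule.finrank_orthogonal_span_singleton (n := n - 1) hp2,
        Fintype.card_fin])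
    rw [heq, Submodule.mem_orthogonal_singleton_iff_inner_right]
    exact hyperp
  obtain ⟨c, hc⟩ := (Submodule.mem_span_range_iff_exists_fun ℝ).1 hspan
  have hell (K) : S.metric n p (rotationField (A K) p) v = radius p ^ 2 * ⟪w K, y⟫_ℝ := by
    rw [metric_apply, hdr, hwK, hy]
    simp [rotationField]
  have hG : (Matrix.of fun K L => sphereMetric p (rotationField (A K) p) (rotationField (A L) p))
      = Matrix.gram ℝ w := by
    ext K L
    simp only [Matrix.of_apply, Matrix.gram_apply, ← hwK]
    rfl
  simp only [hG, hell, ← hy]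
  have hdet : IsUnit (Matrix.gram ℝ w).det :=
    (Matrix.isUnit_iff_isUnit_det _).1
      (Matrix.posDef_gram_of_linearIndependent hwind).isUnit
  have hGc : (fun K => ⟪w K, y⟫_ℝ) = Matrix.mulVec (Matrix.gram ℝ w) c := by
    funext K
    simp [← hc, inner_sum, Matrix.mulVec, dotProduct, real_inner_smul_right, mul_comm]
  have key : ∑ K, ∑ L, (Matrix.gram ℝ w)⁻¹ K L * (radius p ^ 2 * ⟪w K, y⟫_ℝ)
      * (radius p ^ 2 * ⟪w L, y⟫_ℝ) = (radius p ^ 2 * ‖y‖) ^ 2 := by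
    have h1 : Matrix.mulVec (Matrix.gram ℝ w)⁻¹ (fun K => ⟪w K, y⟫_ℝ) = c := by
      rw [hGc, Matrix.mulVec_mulVec, Matrix.nonsing_inv_mul _ hdet, Matrix.one_mulVec]
    calc _ = radius p ^ 4 * ∑ K, ⟪w K, y⟫_ℝ *
          Matrix.mulVec (Matrix.gram ℝ w)⁻¹ (fun K => ⟪w K, y⟫_ℝ) K := by
          simp only [Matrix.mulVec, dotProduct, Finset.mul_sum]
          refine Finset.sum_congr rfl fun K _ => Finset.sum_congr rfl fun L _ => ?_
          ring
      _ = radius p ^ 4 * ⟪∑ K, c K • w K, y⟫_ℝ := by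
          rw [h1, sum_inner]
          simp only [real_inner_smul_left, mul_comm]
      _ = _ := by rw [hc, real_inner_self_eq_norm_sq]; ring
  rw [key, Real.sqrt_sq (by positivity)]

/-- `η`, defined on `W`, is smooth and restricts to the outward (growing `r`) unit normal of `H`
on `H ∩ W`. -/
structure IsOutwardUnitNormalOn (S : ClassS) {n : ℕ} (H W : Set (Pt n)) (η : Pt n → Pt n) :
    Prop where
  smooth : ContDiffOn ℝ ∞ η W
  normal : ∀ q ∈ H ∩ W, ∀ v ∈ tangentSet H q, S.metric n q (η q) v = 0
  unit : ∀ q ∈ H ∩ W, S.metric n q (η q) (η q) = 1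
  outward : ∀ q ∈ H ∩ W, 0 < dr q (η q)

/-- `H` is totally umbilic with constant umbilicity factor `lam`: its second fundamental form
`h(u, v) = g(∇_u η, v)` with respect to the outward unit normal `η` equals `lam` times the
induced metric. -/
def HasUmbilicityFactor (S : ClassS) {n : ℕ} (H : Set (Pt n)) (lam : ℝ) : Prop :=
  ∀ p ∈ H, ∃ (W : Set (Pt n)) (η : Pt n → Pt n), IsOpen W ∧ p ∈ W ∧
    S.IsOutwardUnitNormalOn H W η ∧
    ∀ u ∈ tangentSet H p, ∀ v ∈ tangentSet H p,
      covDerivPairing (S.metric n) η p u v = lam * S.metric n p u v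

/-- The curve `ζ` is future-directed on `J`: `dt(ζ') > 0`. (The time-orientation is that of
`∂_t`.) -/
def IsFutureDirected {n : ℕ} (ζ : ℝ → Pt n) (J : Set ℝ) : Prop :=
  ∀ s ∈ J, 0 < dt n (deriv ζ s)

end ClassS

end PhotonSurfaces

end

/-! A connected, spherically symmetric, timelike hypersurface is a rotated graph r = ρ(t) over an
open interval T, with ρ'² < f(ρ)² (`exists_profile`). Everything reduces to one autonomous equation
for ρ, ρ'' = (f² - ρ'²)/ρ - f f'/2 + (3/2) f' ρ'²/f, with f and f' taken at ρ
(`ClassS.SolvesPhotonODE`).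

A null geodesic conserves E = f t' and ℓ = r²|ξ'|, and nullity reads r'² = E² - ℓ² f/r². As E ≠ 0,
time is a regular parameter, and (dr/dt)² = f² (1 - (ℓ²/E²) f/r²). If ℓ > 0, eliminating ℓ²/E² with
the help of the radial equation gives the equation above, in which neither constant appears.
Conversely (f² - ρ'²)ρ²/f³ is a first integral of that equation; it is positive for timelike graphs
and plays the role of ℓ²/E². From it a null geodesic over the whole of T is recovered by two
quadratures, for the affine parameter and for the angle. The second-order equation is needed because
the first-order one determines ρ' only up to sign and loses uniqueness where ρ' = 0.

Hence generated surfaces are exactly those solving the equation. They are null totally geodesic: a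
null geodesic tangent to a timelike surface has ℓ > 0, so its radius solves the same equation with
the same initial data, and uniqueness applies. Conversely, on a null totally geodesic surface, the
local solution with the data of ρ at t₀ carries a null geodesic tangent to the surface; it stays in
the surface, so ρ agrees with that solution near t₀.

For maximality, a null geodesic inside a symmetric photon surface extends through all its times
(`exists_extension`), so enlarging the surface enlarges the geodesic. Conversely, extending a
generating geodesic produces a larger photon surface. For umbilicity, the normal field is explicit:
the equation gives proportionality of the second fundamental form, and the first integral normalises
the field with the constant |E|/ℓ. -/

noncomputable section

namespace PhotonSurfaces

/-! ### The metric and its geodesic equation in Cartesian coordinates. -/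

section MetricCalculus

variable {n : ℕ} (S : ClassS)

/-- The coefficient of `⟨x, dx⟩²` when the metric is written in Cartesian coordinates. -/
def ClassS.warp (r : ℝ) : ℝ := (1 / S.f r - 1) / r ^ 2

/-- The derivative of the coefficient `warp`. -/
def ClassS.warpDeriv (r : ℝ) : ℝ :=
  (-deriv S.f r / S.f r ^ 2) / r ^ 2 - 2 * (1 / S.f r - 1) / r ^ 3

theorem ClassS.differentiableAt_f {r : ℝ} (hr : r ∈ S.I) : DifferentiableAt ℝ S.f r :=
  (S.smooth.contDiffAt (S.isOpen.mem_nhds hr)).differentiableAt (by simp)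

theorem ClassS.hasDerivAt_warp {r : ℝ} (hr : r ∈ S.I) :
    HasDerivAt S.warp (S.warpDeriv r) r := by
  have hf := (S.f_pos r hr).ne'
  have hr0 : r ≠ 0 := (S.pos hr).ne'
  have h := ((((S.differentiableAt_f hr).hasDerivAt.inv hf).sub_const 1).div
    (hasDerivAt_pow 2 r) (pow_ne_zero 2 hr0))
  have e : S.warp = fun r => ((S.f r)⁻¹ - 1) / r ^ 2 := by
    funext r; simp [ClassS.warp]
  rw [e]
  refine h.congr_deriv ?_
  simp only [ClassS.warpDeriv, Pi.inv_apply]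
  field_simp
  push_cast
  ring

theorem ClassS.snd_ne_zero {p : Pt n} (hp : p ∈ S.carrier n) : p.2 ≠ 0 := by
  intro h
  have : 0 < radius p := S.pos hp
  simp [radius, h] at this

theorem ClassS.isOpen_carrier : IsOpen (S.carrier n) :=
  S.isOpen.preimage (continuous_snd.norm)

theorem dr_apply (p v : Pt n) : dr p v = (radius p)⁻¹ * ⟪p.2, v.2⟫_ℝ := by
  simp [dr, angle, radius]

theorem inner_dξ {p : Pt n} (hp : p.2 ≠ 0) (u v : Pt n) :
    (radius p) ^ 2 * ⟪dξ p u, dξ p v⟫_ℝ = ⟪u.2, v.2⟫_ℝ - dr p u * dr p v := by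
  have hr : ‖p.2‖ ≠ 0 := by simpa using hp
  simp only [dξ, smul_apply, sub_apply, ContinuousLinearMap.smulRight_apply,
    ContinuousLinearMap.coe_snd', real_inner_smul_left, real_inner_smul_right,
    inner_sub_left, inner_sub_right, dr_apply, angle, radius, real_inner_self_eq_norm_sq,
    real_inner_comm p.2]
  field_simp
  ring

/-- Since |dx|² = dr² + r²Ω and ⟨x, dx⟩ = r dr, only the radial coefficient deviates from the flat
one. In this form the angle map has disappeared, so derivatives involve only f and inner products.
-/
theorem ClassS.metric_eq {p : Pt n} (hp : p.2 ≠ 0) (u v : Pt n) :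
    S.metric n p u v = -S.f (radius p) * (u.1 * v.1) + ⟪u.2, v.2⟫_ℝ
      + S.warp (radius p) * (⟪p.2, u.2⟫_ℝ * ⟪p.2, v.2⟫_ℝ) := by
  rw [S.metric_apply, inner_dξ hp, dr_apply, dr_apply, ClassS.warp]
  ring

theorem ClassS.hasFDerivAt_metric_apply {p : Pt n} (hp : p ∈ S.carrier n) (v z : Pt n) :
    ∃ D : Pt n →L[ℝ] ℝ, HasFDerivAt (fun q => S.metric n q v z) D p ∧
      ∀ u, D u = -(deriv S.f (radius p) * (⟪p.2, u.2⟫_ℝ / radius p)) * (v.1 * z.1)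
        + S.warpDeriv (radius p) * (⟪p.2, u.2⟫_ℝ / radius p) * (⟪p.2, v.2⟫_ℝ * ⟪p.2, z.2⟫_ℝ)
        + S.warp (radius p) * (⟪u.2, v.2⟫_ℝ * ⟪p.2, z.2⟫_ℝ + ⟪p.2, v.2⟫_ℝ * ⟪u.2, z.2⟫_ℝ) := by
  have hr := hasFDerivAt_radius p (S.snd_ne_zero hp)
  have hi (w : Pt n) := (hasFDerivAt_snd (𝕜 := ℝ) (p := p)).inner ℝ (hasFDerivAt_const w.2 p)
  have h1 := (((S.differentiableAt_f hp).hasDerivAt.comp_hasFDerivAt p hr).neg.mul_const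
    (v.1 * z.1)).add_const ⟪v.2, z.2⟫_ℝ
  have h2 := h1.add (((S.hasDerivAt_warp hp).comp_hasFDerivAt p hr).mul ((hi v).mul (hi z)))
  refine ⟨_, h2.congr_of_eventuallyEq ?_, fun u => ?_⟩
  · filter_upwards [(S.isOpen_carrier (n := n)).mem_nhds hp] with q hq
    rw [S.metric_eq (S.snd_ne_zero hq)]
    simp
  · simp [dr_apply]
    ring

theorem ClassS.contDiffOn_metric_apply (v z : Pt n) :
    ContDiffOn ℝ ∞ (fun q => S.metric n q v z) (S.carrier n) := by
  have hr : ContDiffOn ℝ ∞ (radius (n := n)) (S.carrier n) :=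
    (contDiffOn_snd).norm ℝ fun q hq => S.snd_ne_zero hq
  have hf : ContDiffOn ℝ ∞ (fun q : Pt n => S.f (radius q)) (S.carrier n) :=
    S.smooth.comp hr fun q hq => hq
  have hi (w : Pt n) : ContDiffOn ℝ ∞ (fun q : Pt n => ⟪q.2, w.2⟫_ℝ) (S.carrier n) :=
    contDiffOn_snd.inner ℝ contDiffOn_const
  have hw : ContDiffOn ℝ ∞ (fun q : Pt n => S.warp (radius q)) (S.carrier n) :=
    ((contDiffOn_const.div hf fun q hq => (S.f_pos _ hq).ne').sub contDiffOn_const).div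
      (hr.pow 2) fun q hq => pow_ne_zero 2 (S.pos hq).ne'
  refine (((hf.neg.mul (contDiffOn_const (c := v.1 * z.1))).add
    (contDiffOn_const (c := ⟪v.2, z.2⟫_ℝ))).add (hw.mul ((hi v).mul (hi z)))).congr ?_
  intro q hq
  exact S.metric_eq (S.snd_ne_zero hq) v z

theorem ClassS.differentiableAt_metric {p : Pt n} (hp : p ∈ S.carrier n) :
    DifferentiableAt ℝ (S.metric n) p := by
  have : ContDiffOn ℝ ∞ (S.metric n) (S.carrier n) :=
    contDiffOn_clm_apply.2 fun v => contDiffOn_clm_apply.2 fun z => S.contDiffOn_metric_apply v z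
  exact (this.contDiffAt (S.isOpen_carrier.mem_nhds hp)).differentiableAt (by simp)

theorem ClassS.fderiv_metric {p : Pt n} (hp : p ∈ S.carrier n) (u v z : Pt n) :
    fderiv ℝ (S.metric n) p u v z =
      -(deriv S.f (radius p) * (⟪p.2, u.2⟫_ℝ / radius p)) * (v.1 * z.1)
        + S.warpDeriv (radius p) * (⟪p.2, u.2⟫_ℝ / radius p) * (⟪p.2, v.2⟫_ℝ * ⟪p.2, z.2⟫_ℝ)
        + S.warp (radius p) *
          (⟪u.2, v.2⟫_ℝ * ⟪p.2, z.2⟫_ℝ + ⟪p.2, v.2⟫_ℝ * ⟪u.2, z.2⟫_ℝ) := by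
  obtain ⟨D, hD, hDu⟩ := S.hasFDerivAt_metric_apply hp v z
  have h := ((S.differentiableAt_metric hp).hasFDerivAt.clm_apply (hasFDerivAt_const v p)).clm_apply
    (hasFDerivAt_const z p)
  rw [← hDu, hD.unique h]
  simp

theorem ClassS.christoffel_metric {p : Pt n} (hp : p ∈ S.carrier n) (u v z : Pt n) :
    christoffel (S.metric n) p u v z =
      -(deriv S.f (radius p) / radius p) / 2
          * (⟪p.2, u.2⟫_ℝ * v.1 + ⟪p.2, v.2⟫_ℝ * u.1) * z.1
        + ((deriv S.f (radius p) / radius p) * (u.1 * v.1)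
          + S.warpDeriv (radius p) / radius p * (⟪p.2, u.2⟫_ℝ * ⟪p.2, v.2⟫_ℝ)
          + 2 * S.warp (radius p) * ⟪u.2, v.2⟫_ℝ) / 2 * ⟪p.2, z.2⟫_ℝ := by
  simp only [christoffel, S.fderiv_metric hp, real_inner_comm v.2 u.2, real_inner_comm z.2 u.2,
    real_inner_comm z.2 v.2]
  ring

/-- The geodesic equation in Cartesian coordinates. -/
theorem ClassS.geodesic_equation_iff {p : Pt n} (hp : p ∈ S.carrier n) (v a : Pt n) :
    (∀ z, S.metric n p a z + christoffel (S.metric n) p v v z = 0) ↔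
      S.f (radius p) * a.1 + deriv S.f (radius p) * (⟪p.2, v.2⟫_ℝ / radius p) * v.1 = 0 ∧
      a.2 = -(S.warp (radius p) * ⟪p.2, a.2⟫_ℝ
          + ((deriv S.f (radius p) / radius p) * v.1 ^ 2
            + S.warpDeriv (radius p) / radius p * ⟪p.2, v.2⟫_ℝ ^ 2
            + 2 * S.warp (radius p) * ‖v.2‖ ^ 2) / 2) • p.2 := by
  simp only [S.metric_eq (S.snd_ne_zero hp), S.christoffel_metric hp]
  constructor
  -- Testing with purely temporal and purely spatial z separates the two components. The spatial one
  -- stays implicit in the acceleration, so the metric is never inverted.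
  · intro h
    constructor
    · have := h (1, 0)
      simp at this
      linear_combination -this
    · refine ext_inner_right ℝ fun z => ?_
      have := h (0, z)
      simp only [mul_zero, zero_add, real_inner_self_eq_norm_sq] at this
      rw [real_inner_smul_left]
      linear_combination this
  · rintro ⟨h1, h2⟩ z
    have h3 := congrArg (fun y => ⟪y, z.2⟫_ℝ) h2
    simp only [real_inner_smul_left] at h3
    rw [real_inner_self_eq_norm_sq]
    linear_combination h3 - z.1 * h1

end MetricCalculus
end PhotonSurfaces

/-! ### One-variable calculus: inverses, constancy and antiderivatives on open intervals. -/

/-- A smooth function on an open interval without critical points is a diffeomorphism onto an open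
interval. -/
theorem exists_contDiffOn_inverse_of_deriv_ne_zero {h : ℝ → ℝ} {J : Set ℝ} (hJo : IsOpen J)
    (hJc : J.OrdConnected) (hh : ContDiffOn ℝ ∞ h J) (hd : ∀ s ∈ J, deriv h s ≠ 0) :
    IsOpen (h '' J) ∧ (h '' J).OrdConnected ∧ Set.InjOn h J ∧
      ∃ τ : ℝ → ℝ, ContDiffOn ℝ ∞ τ (h '' J) ∧ Set.MapsTo τ (h '' J) J ∧
        (∀ s ∈ J, τ (h s) = s) ∧ ∀ t ∈ h '' J, h (τ t) = t := by
  have hinj : Set.InjOn h J := by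
    -- Two equal values would produce a critical point by Rolle's theorem.
    have key : ∀ a ∈ J, ∀ b ∈ J, a < b → h a ≠ h b := by
      intro a ha b hb hab heq
      have hsub : Set.Icc a b ⊆ J := hJc.out ha hb
      obtain ⟨c, hc, hc0⟩ := exists_deriv_eq_zero hab (hh.continuousOn.mono hsub) heq
      exact hd c (hsub (Set.Ioo_subset_Icc_self hc)) hc0
    intro a ha b hb heq
    rcases lt_trichotomy a b with hab | hab | hab
    · exact absurd heq (key a ha b hb hab)
    · exact hab
    · exact absurd heq.symm (key b hb a ha hab)
  have hcd (s : ℝ) (hs : s ∈ J) : ContDiffAt ℝ ∞ h s := hh.contDiffAt (hJo.mem_nhds hs)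
  have hder (s : ℝ) (hs : s ∈ J) : HasFDerivAt h
      (ContinuousLinearEquiv.unitsEquivAut ℝ (Units.mk0 (deriv h s) (hd s hs)) : ℝ →L[ℝ] ℝ) s := by
    refine HasFDerivAt.congr_fderiv
      ((hcd s hs).differentiableAt (by simp)).hasDerivAt.hasFDerivAt ?_
    ext
    simp
  have hmap (s : ℝ) (hs : s ∈ J) : Filter.map h (𝓝 s) = 𝓝 (h s) :=
    ((hcd s hs).hasStrictFDerivAt' (hder s hs) (by simp)).map_nhds_eq_of_equiv
  have hopen : IsOpen (h '' J) := by
    rw [isOpen_iff_mem_nhds]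
    rintro _ ⟨s, hs, rfl⟩
    rw [← hmap s hs]
    exact Filter.image_mem_map (hJo.mem_nhds hs)
  refine ⟨hopen, (hJc.isPreconnected.image h hh.continuousOn).ordConnected, hinj,
    Function.invFunOn h J, ?_, ?_, ?_, ?_⟩
  · rintro _ ⟨s, hs, rfl⟩
    have hloc := (hcd s hs).to_localInverse (hder s hs) (by simp)
    refine (hloc.congr_of_eventuallyEq ?_).contDiffWithinAt
    have hstrict := (hcd s hs).hasStrictFDerivAt' (hder s hs) (by simp)
    have h1 := hstrict.eventually_right_inverse
    have h2 : ∀ᶠ t in 𝓝 (h s), hstrict.localInverse h _ s t ∈ J :=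
      hstrict.localInverse_tendsto.eventually (hJo.mem_nhds hs)
    filter_upwards [h1, h2] with t ht1 ht2
    -- By injectivity the global inverse coincides near h s with the smooth local inverse.
    have hmem : t ∈ h '' J := ⟨_, ht2, ht1⟩
    refine hinj (Function.invFunOn_mem hmem) ht2 ?_
    rw [Function.invFunOn_eq hmem]
    exact ht1.symm
  · exact fun t ht => Function.invFunOn_mem ht
  · exact fun s hs => hinj.leftInvOn_invFunOn hs
  · exact fun t ht => Function.invFunOn_eq ht

/-- A function with vanishing derivative on an open interval is constant. -/
theorem eq_of_hasDerivAt_zero_on_interval {E : Type*} [NormedAddCommGroup E] [NormedSpace ℝ E]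
    {h : ℝ → E} {J : Set ℝ} (hJc : J.OrdConnected) (hh : ∀ s ∈ J, HasDerivAt h 0 s)
    {a b : ℝ} (ha : a ∈ J) (hb : b ∈ J) : h a = h b := by
  have := hJc.convex.norm_image_sub_le_of_norm_hasDerivWithin_le (f := h) (f' := fun _ => 0) (C := 0)
    (fun s hs => (hh s hs).hasDerivWithinAt) (by simp) hb ha
  simpa [sub_eq_zero] using this

/-- A smooth function on an open interval has a smooth antiderivative there. -/
theorem exists_contDiffOn_antiderivative {g : ℝ → ℝ} {T : Set ℝ} (hTo : IsOpen T)
    (hTc : T.OrdConnected) (hg : ContDiffOn ℝ ∞ g T) {t₀ : ℝ} (ht₀ : t₀ ∈ T) (c : ℝ) :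
    ∃ G : ℝ → ℝ, G t₀ = c ∧ (∀ t ∈ T, HasDerivAt G (g t) t) ∧ ContDiffOn ℝ ∞ G T := by
  have hd : ∀ t ∈ T, HasDerivAt (fun t => c + ∫ u in t₀..t, g u) (g t) t := by
    intro t ht
    have hint : IntervalIntegrable g MeasureTheory.volume t₀ t :=
      (hg.continuousOn.mono (hTc.uIcc_subset ht₀ ht)).intervalIntegrable
    have := (intervalIntegral.integral_hasDerivAt_right hint
      (hg.continuousOn.stronglyMeasurableAtFilter hTo t ht)
      (hg.continuousOn.continuousAt (hTo.mem_nhds ht))).const_add c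
    exact this
  refine ⟨fun t => c + ∫ u in t₀..t, g u, by simp, hd, ?_⟩
  rw [contDiffOn_infty_iff_deriv_of_isOpen hTo]
  exact ⟨fun t ht => (hd t ht).differentiableAt.differentiableWithinAt,
    hg.congr fun t ht => (hd t ht).deriv⟩

/-! ### Profiles: rotated timelike graphs r = ρ(t). -/

namespace PhotonSurfaces

theorem _root_.HasDerivAt.fst_comp {n : ℕ} {c : ℝ → Pt n} {v : Pt n} {s : ℝ}
    (hc : HasDerivAt c v s) : HasDerivAt (fun u => (c u).1) v.1 s :=
  (hasFDerivAt_fst (𝕜 := ℝ) (p := c s)).comp_hasDerivAt s hc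

theorem _root_.HasDerivAt.snd_comp {n : ℕ} {c : ℝ → Pt n} {v : Pt n} {s : ℝ}
    (hc : HasDerivAt c v s) : HasDerivAt (fun u => (c u).2) v.2 s :=
  (hasFDerivAt_snd (𝕜 := ℝ) (p := c s)).comp_hasDerivAt s hc

/-- The rotationally symmetric set `r = ρ(t)`, `t ∈ T`. -/
def rotSurface (n : ℕ) (ρ : ℝ → ℝ) (T : Set ℝ) : Set (Pt n) := {p | p.1 ∈ T ∧ ‖p.2‖ = ρ p.1}

/-- A smooth function `ρ : T → I` on an open interval, the graph of whose rotation is timelike. -/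
structure ClassS.IsProfile (S : ClassS) (ρ : ℝ → ℝ) (T : Set ℝ) : Prop where
  isOpen : IsOpen T
  ordConnected : T.OrdConnected
  nonempty : T.Nonempty
  smooth : ContDiffOn ℝ ∞ ρ T
  mapsTo : Set.MapsTo ρ T S.I
  slope : ∀ t ∈ T, deriv ρ t ^ 2 < S.f (ρ t) ^ 2

variable {n : ℕ} {S : ClassS} {ρ : ℝ → ℝ} {T : Set ℝ}

namespace ClassS.IsProfile

theorem hasDerivAt (h : S.IsProfile ρ T) {t : ℝ} (ht : t ∈ T) : HasDerivAt ρ (deriv ρ t) t :=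
  ((h.smooth.contDiffAt (h.isOpen.mem_nhds ht)).differentiableAt (by simp)).hasDerivAt

theorem smooth_deriv (h : S.IsProfile ρ T) : ContDiffOn ℝ ∞ (deriv ρ) T :=
  ((contDiffOn_infty_iff_deriv_of_isOpen h.isOpen).1 h.smooth).2

theorem hasDerivAt_deriv (h : S.IsProfile ρ T) {t : ℝ} (ht : t ∈ T) :
    HasDerivAt (deriv ρ) (deriv (deriv ρ) t) t :=
  ((h.smooth_deriv.contDiffAt (h.isOpen.mem_nhds ht)).differentiableAt (by simp)).hasDerivAt

theorem pos (h : S.IsProfile ρ T) {t : ℝ} (ht : t ∈ T) : 0 < ρ t := S.pos (h.mapsTo ht)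

theorem f_pos (h : S.IsProfile ρ T) {t : ℝ} (ht : t ∈ T) : 0 < S.f (ρ t) := S.f_pos _ (h.mapsTo ht)

theorem mem_carrier (h : S.IsProfile ρ T) {p : Pt n} (hp : p ∈ rotSurface n ρ T) :
    p ∈ S.carrier n := by
  have := h.mapsTo hp.1
  rwa [← hp.2] at this

theorem mem_tangentSet_iff (h : S.IsProfile ρ T) {p : Pt n} (hp : p ∈ rotSurface n ρ T) (v : Pt n) :
    v ∈ tangentSet (rotSurface n ρ T) p ↔ ⟪p.2, v.2⟫_ℝ = ρ p.1 * deriv ρ p.1 * v.1 := by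
  have hp2 : p.2 ≠ 0 := S.snd_ne_zero (h.mem_carrier hp)
  have hpos := h.pos hp.1
  constructor
  · rintro ⟨c, rfl, hc, hcH⟩
    have h1 : HasDerivAt (fun s => ‖(c s).2‖ ^ 2) (2 * ⟪(c 0).2, v.2⟫_ℝ) 0 := hc.snd_comp.norm_sq
    have h2 : HasDerivAt (fun s => ρ (c s).1 ^ 2) _ 0 :=
      ((h.hasDerivAt hp.1).comp (0 : ℝ) hc.fst_comp).pow 2
    have h3 := h1.unique (h2.congr_of_eventuallyEq (by
      filter_upwards [hcH] with s hs
      rw [hs.2]))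
    simp at h3
    linear_combination h3 / 2
  · intro hv
    have hline : HasDerivAt (fun s : ℝ => p.2 + s • v.2) v.2 0 := by
      simpa using ((hasDerivAt_id (0 : ℝ)).smul_const v.2).const_add p.2
    have htime : HasDerivAt (fun s : ℝ => p.1 + s * v.1) v.1 0 := by
      simpa using ((hasDerivAt_id (0 : ℝ)).mul_const v.1).const_add p.1
    have hnorm : HasDerivAt (fun s : ℝ => ‖p.2 + s • v.2‖) (⟪p.2, v.2⟫_ℝ / ‖p.2‖) 0 := by
      have h1 : HasDerivAt (fun s : ℝ => √(‖p.2 + s • v.2‖ ^ 2)) _ 0 :=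
        hline.norm_sq.sqrt (by simpa using hp2)
      have h2 : (fun s : ℝ => √(‖p.2 + s • v.2‖ ^ 2)) = fun s => ‖p.2 + s • v.2‖ := by
        funext s; rw [Real.sqrt_sq (norm_nonneg _)]
      rw [h2] at h1
      refine h1.congr_deriv ?_
      simp only [zero_smul, add_zero, Real.sqrt_sq (norm_nonneg _)]
      field_simp
    have hrad : HasDerivAt (fun s : ℝ => ρ (p.1 + s * v.1)) (deriv ρ p.1 * v.1) 0 :=
      HasDerivAt.comp (0 : ℝ) (by simpa using h.hasDerivAt hp.1) htime
    have hquot : HasDerivAt (fun s : ℝ => ρ (p.1 + s * v.1) / ‖p.2 + s • v.2‖) 0 0 := by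
      refine (hrad.div hnorm (by simpa using hp2)).congr_deriv ?_
      simp only [zero_smul, add_zero, zero_mul, hv, hp.2]
      field_simp
      ring
    -- The straight line with velocity v, rescaled radially onto the surface. The condition on v
    -- says that the scaling factor has derivative zero at s = 0, so the initial velocity is still
    -- v.
    refine ⟨fun s => (p.1 + s * v.1, (ρ (p.1 + s * v.1) / ‖p.2 + s • v.2‖) • (p.2 + s • v.2)),
      ?_, ?_, ?_⟩
    · ext1
      · simp
      · simp [hp.2, hpos.ne']
    · refine htime.prodMk ((hquot.smul hline).congr_deriv ?_)
      simp [hp.2, hpos.ne']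
    · have e1 : ∀ᶠ s : ℝ in 𝓝 0, p.1 + s * v.1 ∈ T :=
        htime.continuousAt.eventually (by simpa using h.isOpen.mem_nhds hp.1)
      have e2 : ∀ᶠ s : ℝ in 𝓝 0, p.2 + s • v.2 ≠ 0 :=
        hline.continuousAt.eventually_ne (by simpa using hp2)
      filter_upwards [e1, e2] with s hs1 hs2
      refine ⟨hs1, ?_⟩
      have := h.pos hs1
      simp only [norm_smul, norm_div, norm_norm, Real.norm_of_nonneg this.le]
      field_simp

theorem isHypersurface (h : S.IsProfile ρ T) :
    IsHypersurface (S.carrier n) (rotSurface n ρ T) := by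
  refine ⟨fun p hp => h.mem_carrier hp, fun p hp => ?_⟩
  have hsm : ContDiffOn ℝ ∞ (fun q : Pt n => ‖q.2‖ - ρ q.1)
      (Prod.fst ⁻¹' T ∩ S.carrier n) := by
    refine ((contDiffOn_snd).norm ℝ fun q hq => S.snd_ne_zero hq.2).sub ?_
    exact h.smooth.comp contDiffOn_fst fun q hq => hq.1
  refine ⟨Prod.fst ⁻¹' T ∩ S.carrier n, fun q => ‖q.2‖ - ρ q.1,
    (h.isOpen.preimage continuous_fst).inter S.isOpen_carrier, ⟨hp.1, h.mem_carrier hp⟩,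
    hsm, ?_, ?_⟩
  · intro q hq hzero
    have h1 := (hasFDerivAt_radius q (S.snd_ne_zero hq.2)).sub
      ((h.hasDerivAt hq.1).comp_hasFDerivAt q hasFDerivAt_fst)
    have h2 : HasFDerivAt (fun q : Pt n => ‖q.2‖ - ρ q.1) _ q := h1
    rw [h2.fderiv] at hzero
    have h3 := congrArg (fun D => D (0, q.2)) hzero
    have : ‖q.2‖ ≠ 0 := by simpa using S.snd_ne_zero hq.2
    simp [dr_apply, radius, this] at h3
  · intro q hq
    rw [sub_eq_zero]
    exact ⟨fun hq' => hq'.2, fun hq' => ⟨hq.1, hq'⟩⟩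

theorem isTimelike (h : S.IsProfile ρ T) : IsTimelike (S.metric n) (rotSurface n ρ T) := by
  intro p hp
  have hp2 := S.snd_ne_zero (h.mem_carrier hp)
  have hpos := h.pos hp.1
  have hf := h.f_pos hp.1
  have hslope := h.slope _ hp.1
  have hrad : radius p = ρ p.1 := hp.2
  have hself : ⟪p.2, p.2⟫_ℝ = ρ p.1 ^ 2 := by rw [real_inner_self_eq_norm_sq, hp.2]
  have hneg : deriv ρ p.1 ^ 2 / S.f (ρ p.1) - S.f (ρ p.1) < 0 := by
    rw [sub_neg, div_lt_iff₀ hf, ← sq]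
    exact hslope
  -- The timelike witness is the meridian direction ∂_t + ρ' ∂_r, whose square is ρ'²/f - f.
  refine ⟨(1, (deriv ρ p.1 / ρ p.1) • p.2), (h.mem_tangentSet_iff hp _).2 ?_, ?_, ?_⟩
  · simp only [real_inner_smul_right, hself]
    field_simp
  · rw [S.metric_eq hp2, hrad]
    simp only [real_inner_smul_right, real_inner_smul_left, hself, ClassS.warp]
    convert hneg using 1
    field_simp
    ring
  · intro w hw horth hw0
    rw [h.mem_tangentSet_iff hp] at hw
    rw [S.metric_eq hp2, hrad] at horth ⊢
    simp only [real_inner_smul_right, real_inner_smul_left, hself, ClassS.warp, hw] at horth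
    have h1 : w.1 * (deriv ρ p.1 ^ 2 / S.f (ρ p.1) - S.f (ρ p.1)) = 0 := by
      rw [← horth]
      field_simp
      ring
    -- A tangent vector orthogonal to the meridian is tangent to the sphere, where the metric is
    -- Euclidean.
    have hw1 : w.1 = 0 := (mul_eq_zero.1 h1).resolve_right hneg.ne
    rw [hw, hw1, real_inner_self_eq_norm_sq]
    have hw2 : w.2 ≠ 0 := fun h2 => hw0 (Prod.ext hw1 h2)
    have : 0 < ‖w.2‖ := norm_pos_iff.2 hw2
    simp only [mul_zero, zero_add, add_zero]
    positivity

theorem mem_rotSurface_smul (h : S.IsProfile ρ T) {t : ℝ} (ht : t ∈ T)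
    {ξ : EuclideanSpace ℝ (Fin n)} (hξ : ‖ξ‖ = 1) : ((t, ρ t • ξ) : Pt n) ∈ rotSurface n ρ T :=
  ⟨ht, by simp [norm_smul, hξ, abs_of_pos (h.pos ht)]⟩

theorem isSphericallySymmetric (h : S.IsProfile ρ T) :
    S.IsSphericallySymmetric (rotSurface n ρ T) := by
  rintro t₀ ⟨p, hp, rfl⟩
  refine ⟨ρ p.1, h.mapsTo hp.1, ?_⟩
  ext q
  constructor
  · rintro ⟨hq, hqt⟩
    have hq2 : ‖q.2‖ ≠ 0 := by simpa using S.snd_ne_zero (h.mem_carrier hq)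
    have hqt' : q.1 = p.1 := hqt
    refine ⟨hqt, ‖q.2‖⁻¹ • q.2, by simp [norm_smul, hq2], ?_⟩
    rw [← hqt', ← hq.2, smul_smul, mul_inv_cancel₀ hq2, one_smul]
  · rintro ⟨hqt, ξ, hξ, hq⟩
    have hqt' : q.1 = p.1 := hqt
    refine ⟨?_, hqt⟩
    have := h.mem_rotSurface_smul hp.1 (mem_sphere_zero_iff_norm.1 hξ)
    rwa [← hq, ← hqt'] at this

theorem isConnected (h : S.IsProfile ρ T) (hn : 2 ≤ n) : IsConnected (rotSurface n ρ T) := by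
  have hsph : IsConnected (Metric.sphere (0 : EuclideanSpace ℝ (Fin n)) 1) := by
    refine isConnected_sphere ?_ _ zero_le_one
    rw [← Module.finrank_eq_rank, finrank_euclideanSpace_fin]
    exact_mod_cast hn
  have hT : IsConnected T := ⟨h.nonempty, h.ordConnected.isPreconnected⟩
  have himg : rotSurface n ρ T = (fun q : ℝ × EuclideanSpace ℝ (Fin n) => ((q.1, ρ q.1 • q.2) : Pt n))
      '' (T ×ˢ Metric.sphere (0 : EuclideanSpace ℝ (Fin n)) 1) := by
    ext q
    constructor
    · intro hq
      have hq2 : ‖q.2‖ ≠ 0 := by simpa using S.snd_ne_zero (h.mem_carrier hq)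
      refine ⟨(q.1, ‖q.2‖⁻¹ • q.2), ⟨hq.1, by simp [norm_smul, hq2]⟩, ?_⟩
      simp [← hq.2, smul_smul, hq2]
    · rintro ⟨⟨t, ξ⟩, ⟨ht, hξ⟩, rfl⟩
      exact h.mem_rotSurface_smul ht (mem_sphere_zero_iff_norm.1 hξ)
  rw [himg]
  refine (hT.prod hsph).image _ ?_
  have hρ : ContinuousOn (fun q : ℝ × EuclideanSpace ℝ (Fin n) => ρ q.1)
      (T ×ˢ Metric.sphere (0 : EuclideanSpace ℝ (Fin n)) 1) :=
    h.smooth.continuousOn.comp continuousOn_fst fun q hq => hq.1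
  exact continuousOn_fst.prodMk (hρ.smul continuousOn_snd)

end ClassS.IsProfile

/-- A connected, spherically symmetric, timelike hypersurface is the rotation of a profile. -/
theorem exists_profile {H : Set (Pt n)} (hH : IsHypersurface (S.carrier n) H)
    (hconn : IsConnected H) (hsym : S.IsSphericallySymmetric H) (htime : IsTimelike (S.metric n) H) :
    ∃ (ρ : ℝ → ℝ) (T : Set ℝ), S.IsProfile ρ T ∧ H = rotSurface n ρ T := by
  -- The implication sits inside the existential so that `choose` yields a radius function defined
  -- on all of ℝ; its value is arbitrary at times that H misses.
  have hslice : ∀ t, ∃ r, t ∈ Prod.fst '' H → r ∈ S.I ∧ ∀ p : Pt n, p.1 = t → (p ∈ H ↔ ‖p.2‖ = r) := by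
    intro t
    by_cases ht : t ∈ Prod.fst '' H
    · obtain ⟨p, hp, hpt⟩ := ht
      obtain ⟨r, hr, hset⟩ := hsym t ⟨p, hp, hpt⟩
      have hr0 : 0 < r := S.pos hr
      refine ⟨r, fun _ => ⟨hr, fun q hq => ?_⟩⟩
      have hq' := Set.ext_iff.1 hset q
      have hqt : timeCoord q = t := hq
      simp only [Set.mem_ofPred_eq, hqt, and_true, true_and] at hq'
      rw [hq']
      constructor
      · rintro ⟨ξ, hξ, h⟩
        rw [h, norm_smul, mem_sphere_zero_iff_norm.1 hξ, Real.norm_of_nonneg hr0.le, mul_one]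
      · intro h
        have : ‖q.2‖ ≠ 0 := by rw [h]; exact hr0.ne'
        refine ⟨‖q.2‖⁻¹ • q.2, by simp [norm_smul, this], ?_⟩
        rw [← h, smul_smul, mul_inv_cancel₀ this, one_smul]
    · exact ⟨0, fun h => absurd h ht⟩
  choose ρ hρ using hslice
  obtain ⟨T, hT⟩ : ∃ T, T = Prod.fst '' H := ⟨_, rfl⟩
  rw [← hT] at hρ
  have hmemT {p : Pt n} (hp : p ∈ H) : p.1 ∈ T := hT ▸ ⟨p, hp, rfl⟩
  have hgraph : H = rotSurface n ρ T := by
    ext p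
    refine ⟨fun hp => ⟨hmemT hp, ((hρ _ (hmemT hp)).2 p rfl).1 hp⟩, fun hp => ?_⟩
    exact ((hρ _ hp.1).2 p rfl).2 hp.2
  have hlocal : ∀ t ∈ T, T ∈ 𝓝 t ∧ ContDiffAt ℝ ∞ ρ t := by
    intro t ht
    rw [hT] at ht
    obtain ⟨p, hp, rfl⟩ := ht
    obtain ⟨W, F, hWo, hpW, hF, hdF, hFH⟩ := hH.2 p hp
    have hp2 : p.2 ≠ 0 := S.snd_ne_zero (hH.1 hp)
    have hpn : ‖p.2‖ ≠ 0 := by simpa using hp2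
    have hFp : ContDiffAt ℝ ∞ F p := hF.contDiffAt (hWo.mem_nhds hpW)
    have hker : ∀ v ∈ tangentSet H p, fderiv ℝ F p v = 0 := by
      rintro v ⟨c, rfl, hc, hcH⟩
      have h1 := (hFp.differentiableAt (by simp)).hasFDerivAt.comp_hasDerivAt (0 : ℝ) hc
      refine h1.unique ((hasDerivAt_const (0 : ℝ) (0 : ℝ)).congr_of_eventuallyEq ?_)
      filter_upwards [hcH, hc.continuousAt.eventually (hWo.mem_nhds hpW)] with s hs hsW
      exact (hFH _ hsW).1 hs
    -- Moving p within the sphere of its slice stays in H, so dF vanishes on directions tangent to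
    -- that sphere.
    have hsph : ∀ w, ⟪p.2, w⟫_ℝ = 0 → fderiv ℝ F p (0, w) = 0 := by
      intro w hw
      refine hker _ ⟨fun s => (p.1, (‖p.2‖ / ‖p.2 + s • w‖) • (p.2 + s • w)), ?_, ?_, ?_⟩
      · ext1 <;> simp [hpn]
      · have hline : HasDerivAt (fun s : ℝ => p.2 + s • w) w 0 := by
          simpa using ((hasDerivAt_id (0 : ℝ)).smul_const w).const_add p.2
        have hnorm : HasDerivAt (fun s : ℝ => ‖p.2 + s • w‖) 0 0 := by
          have h1 : HasDerivAt (fun s : ℝ => √(‖p.2 + s • w‖ ^ 2)) _ 0 :=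
            hline.norm_sq.sqrt (by simpa using hp2)
          have h2 : (fun s : ℝ => √(‖p.2 + s • w‖ ^ 2)) = fun s => ‖p.2 + s • w‖ := by
            funext s; rw [Real.sqrt_sq (norm_nonneg _)]
          rw [h2] at h1
          exact h1.congr_deriv (by simp [hw])
        have hq : HasDerivAt (fun s : ℝ => ‖p.2‖ / ‖p.2 + s • w‖) 0 0 :=
          ((hasDerivAt_const (0 : ℝ) ‖p.2‖).div hnorm (by simpa using hp2)).congr_deriv (by simp)
        exact (hasDerivAt_const _ _).prodMk ((hq.smul hline).congr_deriv (by simp [hpn]))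
      · have e : ContinuousAt (fun s : ℝ => p.2 + s • w) 0 := by fun_prop
        filter_upwards [e.eventually_ne (y := 0) (by simpa using hp2)] with s hs
        have : ‖p.2 + s • w‖ ≠ 0 := by simpa using hs
        refine ((hρ p.1 (hmemT hp)).2 (p.1, (‖p.2‖ / ‖p.2 + s • w‖) • (p.2 + s • w)) rfl).2 ?_
        rw [← ((hρ p.1 (hmemT hp)).2 p rfl).1 hp]
        simp only [norm_smul, norm_div, norm_norm]
        field_simp
    obtain ⟨v, hv, hvneg, -⟩ := htime p hp
    -- Without a time component the metric is a sum of non-negative terms.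
    have hv1 : v.1 ≠ 0 := by
      intro h0
      rw [S.metric_apply, h0] at hvneg
      have := S.f_pos _ (hH.1 hp)
      simp only [mul_zero, zero_add, real_inner_self_eq_norm_sq] at hvneg
      have : 0 ≤ 1 / S.f (radius p) * (dr p v * dr p v) + radius p ^ 2 * ‖dξ p v‖ ^ 2 := by
        have := mul_self_nonneg (dr p v)
        positivity
      linarith
    -- This is where timelikeness gives a graph over t. If dF also killed the radial direction, it
    -- would kill all spatial directions; evaluated on the timelike tangent vector, whose time
    -- component is non-zero, it would then kill ∂_t too.
    have hrad : fderiv ℝ F p (0, p.2) ≠ 0 := by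
      intro h0
      have hsplit : ∀ y, fderiv ℝ F p (0, y) = 0 := by
        intro y
        have hy := hsph (y - (⟪p.2, y⟫_ℝ / ‖p.2‖ ^ 2) • p.2) (by
          rw [inner_sub_right, real_inner_smul_right, real_inner_self_eq_norm_sq]
          field_simp
          ring)
        have e : ((0, y) : Pt n) = (0, y - (⟪p.2, y⟫_ℝ / ‖p.2‖ ^ 2) • p.2)
            + (⟪p.2, y⟫_ℝ / ‖p.2‖ ^ 2) • (0, p.2) := by
          ext1 <;> simp
        rw [e, map_add, map_smul, hy, h0]
        simp
      have htm : fderiv ℝ F p (1, 0) = 0 := by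
        have e : v = v.1 • ((1, 0) : Pt n) + (0, v.2) := by ext1 <;> simp
        have h1 := hker v hv
        rw [e, map_add, map_smul, hsplit, add_zero, smul_eq_mul] at h1
        exact (mul_eq_zero.1 h1).resolve_left hv1
      refine hdF p hpW (ContinuousLinearMap.ext fun y => ?_)
      have e : y = y.1 • ((1, 0) : Pt n) + (0, y.2) := by ext1 <;> simp
      rw [e, map_add, map_smul, hsplit, htm]
      simp
    -- The implicit function theorem is applied on the plane spanned by ∂_t and the line through
    -- p.2. The solution ψ is the radius in units of ‖p.2‖, hence the base value 1.
    let L : ℝ × ℝ → Pt n := fun q => (q.1, q.2 • p.2)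
    have hL : ContDiff ℝ ∞ L := contDiff_fst.prodMk (contDiff_snd.smul contDiff_const)
    have hL1 : L (p.1, 1) = p := by ext1 <;> simp [L]
    have hG : ContDiffAt ℝ ∞ (F ∘ L) (p.1, 1) :=
      ContDiffAt.comp _ (by rwa [hL1]) hL.contDiffAt
    have hLd : HasFDerivAt L ((ContinuousLinearMap.fst ℝ ℝ ℝ).prod
        ((ContinuousLinearMap.snd ℝ ℝ ℝ).smulRight p.2)) (p.1, 1) :=
      hasFDerivAt_fst.prodMk (hasFDerivAt_snd.smul_const p.2)
    have hGd : fderiv ℝ (F ∘ L) (p.1, 1) (0, 1) = fderiv ℝ F p (0, p.2) := by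
      have h1 : HasFDerivAt F (fderiv ℝ F p) (L (p.1, 1)) := by
        rw [hL1]
        exact (hFp.differentiableAt (by simp)).hasFDerivAt
      rw [(h1.comp _ hLd).fderiv]
      simp
    have hinv : (fderiv ℝ (F ∘ L) (p.1, 1) ∘L .inr ℝ ℝ ℝ).IsInvertible := by
      refine ⟨ContinuousLinearEquiv.unitsEquivAut ℝ (Units.mk0 _ hrad), ?_⟩
      ext
      simp [hGd]
    have hψ0 := hG.implicitFunction_apply_self (by simp) hinv
    have hψ := hG.eventually_apply_implicitFunction (by simp) hinv
    have hψs := hG.contDiffAt_implicitFunction (by simp) hinv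
    obtain ⟨ψ, hψe⟩ : ∃ ψ, ψ = hG.implicitFunction (by simp) hinv := ⟨_, rfl⟩
    rw [← hψe] at hψ0 hψ hψs
    simp only at hψ0 hψ hψs
    have hcont : ContinuousAt (fun t => L (t, ψ t)) p.1 :=
      hL.continuous.continuousAt.comp (continuousAt_id.prodMk hψs.continuousAt)
    have hmem : ∀ᶠ t in 𝓝 p.1, L (t, ψ t) ∈ H ∧ 0 < ψ t := by
      have e1 : ∀ᶠ t in 𝓝 p.1, L (t, ψ t) ∈ W :=
        hcont.eventually (by simpa [hψ0, hL1] using hWo.mem_nhds hpW)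
      have e2 : ∀ᶠ t in 𝓝 p.1, 0 < ψ t := hψs.continuousAt.eventually_const_lt (by simp [hψ0])
      filter_upwards [e1, e2, hψ] with t h1 h2 h3
      refine ⟨(hFH _ h1).2 ?_, h2⟩
      have h4 : F (L (t, ψ t)) = F (L (p.1, 1)) := h3
      rw [h4, hL1]
      exact (hFH p hpW).1 hp
    constructor
    · filter_upwards [hmem] with t ht
      exact hmemT ht.1
    · refine (hψs.mul (contDiffAt_const (c := ‖p.2‖))).congr_of_eventuallyEq ?_
      filter_upwards [hmem] with t ht
      rw [← ((hρ t (hmemT ht.1)).2 _ rfl).1 ht.1, norm_smul, Real.norm_of_nonneg ht.2.le]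
  have hopen : IsOpen T := isOpen_iff_mem_nhds.2 fun t ht => (hlocal t ht).1
  have hd (t : ℝ) (ht : t ∈ T) : HasDerivAt ρ (deriv ρ t) t :=
    ((hlocal t ht).2.differentiableAt (by simp)).hasDerivAt
  refine ⟨ρ, T, ⟨hopen, ?_, ?_, fun t ht => (hlocal t ht).2.contDiffWithinAt,
    fun t ht => (hρ t ht).1, ?_⟩, hgraph⟩
  · rw [hT]
    exact (hconn.isPreconnected.image _ continuous_fst.continuousOn).ordConnected
  · rw [hT]
    exact hconn.nonempty.image _
  · intro t ht
    rw [hT] at ht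
    obtain ⟨p, hp, rfl⟩ := ht
    obtain ⟨v, ⟨c, hc0, hc, hcH⟩, hvneg, -⟩ := htime p hp
    have hp2 : p.2 ≠ 0 := S.snd_ne_zero (hH.1 hp)
    have hpn : ‖p.2‖ = ρ p.1 := ((hρ p.1 (hmemT hp)).2 p rfl).1 hp
    have hf := S.f_pos _ (hH.1 hp)
    have hr : 0 < radius p := S.pos (hH.1 hp)
    have h1 : HasDerivAt (fun s => radius (c s)) (dr p v) 0 := by
      subst hc0
      exact (hasFDerivAt_radius (c 0) hp2).comp_hasDerivAt (0 : ℝ) hc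
    have h2 : HasDerivAt (fun s => ρ (c s).1) (deriv ρ p.1 * v.1) 0 := by
      subst hc0
      exact (hd _ (hmemT hp)).comp (0 : ℝ) hc.fst_comp
    have h3 := h1.unique (h2.congr_of_eventuallyEq (by
      filter_upwards [hcH] with s hs
      exact ((hρ _ (hmemT hs)).2 _ rfl).1 hs))
    rw [S.metric_apply, h3, real_inner_self_eq_norm_sq] at hvneg
    have hrad : radius p = ρ p.1 := hpn
    rw [hrad] at hvneg hf
    have h4 : 0 ≤ ρ p.1 ^ 2 * ‖dξ p v‖ ^ 2 := by positivity
    have h5 : v.1 ^ 2 * deriv ρ p.1 ^ 2 < v.1 ^ 2 * S.f (ρ p.1) ^ 2 := by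
      have h6 : -S.f (ρ p.1) * (v.1 * v.1)
          + 1 / S.f (ρ p.1) * (deriv ρ p.1 * v.1 * (deriv ρ p.1 * v.1)) < 0 := by linarith
      have h7 := mul_neg_of_neg_of_pos h6 hf
      have h8 : (-S.f (ρ p.1) * (v.1 * v.1)
          + 1 / S.f (ρ p.1) * (deriv ρ p.1 * v.1 * (deriv ρ p.1 * v.1))) * S.f (ρ p.1)
          = v.1 ^ 2 * deriv ρ p.1 ^ 2 - v.1 ^ 2 * S.f (ρ p.1) ^ 2 := by
        field_simp
        ring
      linarith
    -- Along a curve in H with timelike velocity v one has dr(v) = ρ' dt(v). Dropping the spherical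
    -- term from g(v, v) < 0 leaves the slope bound times dt(v)².
    exact lt_of_mul_lt_mul_left h5 (sq_nonneg _)

end PhotonSurfaces

/-! ### Conserved quantities, and the radius of a null geodesic as a function of time. -/

namespace PhotonSurfaces

section Geodesics

variable {V : Type*} [NormedAddCommGroup V] [NormedSpace ℝ V]
  {g : V → V →L[ℝ] V →L[ℝ] ℝ} {U : Set V} {ζ : ℝ → V} {J : Set ℝ}

theorem IsGeodesic.hasDerivAt (h : IsGeodesic g U ζ J) {s : ℝ} (hs : s ∈ J) :
    HasDerivAt ζ (deriv ζ s) s :=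
  ((h.smooth.contDiffAt (h.isOpen.mem_nhds hs)).differentiableAt (by simp)).hasDerivAt

theorem IsGeodesic.hasDerivAt_deriv (h : IsGeodesic g U ζ J) {s : ℝ} (hs : s ∈ J) :
    HasDerivAt (deriv ζ) (deriv (deriv ζ) s) s :=
  ((((contDiffOn_infty_iff_deriv_of_isOpen h.isOpen).1 h.smooth).2.contDiffAt
    (h.isOpen.mem_nhds hs)).differentiableAt (by simp)).hasDerivAt

/-- The causal character of a geodesic is constant. -/
theorem IsGeodesic.metric_deriv_eq (h : IsGeodesic g U ζ J) (hg : ∀ p ∈ U, DifferentiableAt ℝ g p)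
    (hsymm : ∀ p ∈ U, ∀ u v, g p u v = g p v u) {a b : ℝ} (ha : a ∈ J) (hb : b ∈ J) :
    g (ζ a) (deriv ζ a) (deriv ζ a) = g (ζ b) (deriv ζ b) (deriv ζ b) := by
  refine eq_of_hasDerivAt_zero_on_interval (h := fun s => g (ζ s) (deriv ζ s) (deriv ζ s))
    h.ordConnected (fun s hs => ?_) ha hb
  have h1 : HasDerivAt (fun s => g (ζ s)) (fderiv ℝ g (ζ s) (deriv ζ s)) s :=
    HasFDerivAt.comp_hasDerivAt (l := g) (l' := fderiv ℝ g (ζ s)) s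
      (hg _ (h.mapsTo hs)).hasFDerivAt (h.hasDerivAt hs)
  have h2 := (h1.clm_apply (h.hasDerivAt_deriv hs)).clm_apply (h.hasDerivAt_deriv hs)
  refine h2.congr_deriv ?_
  -- Contracted with the velocity, two of the three Koszul terms cancel, and the equation becomes
  -- half the derivative of g(ζ', ζ').
  have h3 := h.eqn s hs (deriv ζ s)
  have h4 := hsymm _ (h.mapsTo hs) (deriv (deriv ζ) s) (deriv ζ s)
  simp only [christoffel] at h3
  simp only [add_apply]
  linarith

end Geodesics

variable {n : ℕ} {S : ClassS}

/-- The radial acceleration of a null geodesic in terms of its conserved quantities. -/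
theorem radial_acceleration_identity {r f f' τ q N A ℓ : ℝ} (hr : r ≠ 0) (hf : f ≠ 0)
    (hA : A = -((1 / f - 1) / r ^ 2 * A + (f' / r * τ ^ 2
      + ((-f' / f ^ 2) / r ^ 2 - 2 * (1 / f - 1) / r ^ 3) / r * q ^ 2
      + 2 * ((1 / f - 1) / r ^ 2) * N) / 2) * r ^ 2)
    (hnull : -f * (τ * τ) + N + (1 / f - 1) / r ^ 2 * (q * q) = 0)
    (hℓ : ℓ ^ 2 = r ^ 2 * N - q ^ 2) :
    A / r + ℓ ^ 2 / r ^ 3 = f * ℓ ^ 2 / r ^ 3 - f' * ℓ ^ 2 / (2 * r ^ 2) := by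
  have hτ : τ ^ 2 = (N + (1 / f - 1) / r ^ 2 * q ^ 2) / f := by
    field_simp at hnull ⊢
    linear_combination -hnull
  -- The implicit equation for A has total coefficient 1 + (1/f - 1) = 1/f, so multiplying by f
  -- solves it.
  have hA' : A = -f * r ^ 2 / 2 * (f' / r * τ ^ 2
      + ((-f' / f ^ 2) / r ^ 2 - 2 * (1 / f - 1) / r ^ 3) / r * q ^ 2
      + 2 * ((1 / f - 1) / r ^ 2) * N) := by
    field_simp at hA ⊢
    linear_combination hA
  rw [hA', hτ, hℓ]
  field_simp
  ring

theorem ClassS.metric_symm {p : Pt n} (hp : p ∈ S.carrier n) (u v : Pt n) :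
    S.metric n p u v = S.metric n p v u := by
  rw [S.metric_eq (S.snd_ne_zero hp), S.metric_eq (S.snd_ne_zero hp), real_inner_comm]
  ring

theorem ClassS.energy_eq {ζ : ℝ → Pt n} {s : ℝ} (h : ζ s ∈ S.carrier n) :
    S.energy ζ s = S.f (radius (ζ s)) * (deriv ζ s).1 := by
  simp [ClassS.energy, S.metric_eq (S.snd_ne_zero h), partialT]

/-- The right side is the Gram determinant of x and x'; this polynomial form is the convenient one
to differentiate. -/
theorem ClassS.angularMomentum_sq {ζ : ℝ → Pt n} {s : ℝ} (h : ζ s ∈ S.carrier n) :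
    angularMomentum ζ s ^ 2
      = radius (ζ s) ^ 2 * ‖(deriv ζ s).2‖ ^ 2 - ⟪(ζ s).2, (deriv ζ s).2⟫_ℝ ^ 2 := by
  have h1 := inner_dξ (S.snd_ne_zero h) (deriv ζ s) (deriv ζ s)
  rw [real_inner_self_eq_norm_sq, real_inner_self_eq_norm_sq, dr_apply] at h1
  have hr : radius (ζ s) ≠ 0 := (S.pos h).ne'
  rw [angularMomentum, mul_pow]
  calc _ = radius (ζ s) ^ 2 * (radius (ζ s) ^ 2 * ‖dξ (ζ s) (deriv ζ s)‖ ^ 2) := by ring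
    _ = _ := by
      rw [h1]
      field_simp

variable {ζ : ℝ → Pt n} {J : Set ℝ}

theorem IsGeodesic.radius_pos (h : IsGeodesic (S.metric n) (S.carrier n) ζ J)
    {s : ℝ} (hs : s ∈ J) : 0 < radius (ζ s) := S.pos (h.mapsTo hs)

theorem IsGeodesic.f_pos (h : IsGeodesic (S.metric n) (S.carrier n) ζ J)
    {s : ℝ} (hs : s ∈ J) : 0 < S.f (radius (ζ s)) := S.f_pos _ (h.mapsTo hs)

theorem IsGeodesic.hasDerivAt_radius (h : IsGeodesic (S.metric n) (S.carrier n) ζ J)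
    {s : ℝ} (hs : s ∈ J) :
    HasDerivAt (fun s => radius (ζ s)) (dr (ζ s) (deriv ζ s)) s :=
  (hasFDerivAt_radius _ (S.snd_ne_zero (h.mapsTo hs))).comp_hasDerivAt s (h.hasDerivAt hs)

/-- The spatial acceleration of a geodesic is central. -/
theorem IsGeodesic.snd_deriv_deriv (h : IsGeodesic (S.metric n) (S.carrier n) ζ J)
    {s : ℝ} (hs : s ∈ J) :
    (deriv (deriv ζ) s).2
      = (⟪(ζ s).2, (deriv (deriv ζ) s).2⟫_ℝ / radius (ζ s) ^ 2) • (ζ s).2 := by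
  have h2 := ((S.geodesic_equation_iff (h.mapsTo hs) _ _).1 (h.eqn s hs)).2
  obtain ⟨c, hc⟩ : ∃ c : ℝ, (deriv (deriv ζ) s).2 = c • (ζ s).2 := ⟨_, h2⟩
  have hr : ‖(ζ s).2‖ ≠ 0 := (h.radius_pos hs).ne'
  rw [hc, real_inner_smul_right, real_inner_self_eq_norm_sq, radius]
  congr 1
  field_simp

/-- The time component of the geodesic equation is (f t')' = 0. -/
theorem IsGeodesic.energy_eq_energy (h : IsGeodesic (S.metric n) (S.carrier n) ζ J)
    {a b : ℝ} (ha : a ∈ J) (hb : b ∈ J) : S.energy ζ a = S.energy ζ b := by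
  rw [S.energy_eq (h.mapsTo ha), S.energy_eq (h.mapsTo hb)]
  refine eq_of_hasDerivAt_zero_on_interval
    (h := fun s => S.f (radius (ζ s)) * (deriv ζ s).1) h.ordConnected (fun s hs => ?_) ha hb
  have h1 := ((S.differentiableAt_f (h.mapsTo hs)).hasDerivAt.comp s (h.hasDerivAt_radius hs)).mul
    (h.hasDerivAt_deriv hs).fst_comp
  refine h1.congr_deriv ?_
  have h2 := ((S.geodesic_equation_iff (h.mapsTo hs) _ _).1 (h.eqn s hs)).1
  rw [dr_apply]
  simp only [Function.comp]
  linear_combination h2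

/-- The acceleration x'' is parallel to x, so the Gram determinant of x and x' has zero derivative.
-/
theorem IsGeodesic.angularMomentum_eq_angularMomentum (h : IsGeodesic (S.metric n) (S.carrier n) ζ J)
    {a b : ℝ} (ha : a ∈ J) (hb : b ∈ J) : ClassS.angularMomentum ζ a = ClassS.angularMomentum ζ b := by
  have key : ClassS.angularMomentum ζ a ^ 2 = ClassS.angularMomentum ζ b ^ 2 := by
    rw [S.angularMomentum_sq (h.mapsTo ha), S.angularMomentum_sq (h.mapsTo hb)]
    refine eq_of_hasDerivAt_zero_on_interval (h := fun s =>
      radius (ζ s) ^ 2 * ‖(deriv ζ s).2‖ ^ 2 - ⟪(ζ s).2, (deriv ζ s).2⟫_ℝ ^ 2)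
      h.ordConnected (fun s hs => ?_) ha hb
    have h1 := (((h.hasDerivAt_radius hs).pow 2).mul
      (h.hasDerivAt_deriv hs).snd_comp.norm_sq).sub
      (((h.hasDerivAt hs).snd_comp.inner ℝ (h.hasDerivAt_deriv hs).snd_comp).pow 2)
    refine h1.congr_deriv ?_
    have hr := (h.radius_pos hs).ne'
    obtain ⟨c, hc⟩ : ∃ c : ℝ, (deriv (deriv ζ) s).2 = c • (ζ s).2 := ⟨_, h.snd_deriv_deriv hs⟩
    have hself : ⟪(ζ s).2, (ζ s).2⟫_ℝ = radius (ζ s) ^ 2 := real_inner_self_eq_norm_sq _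
    simp only [dr_apply, hc, real_inner_smul_right, hself, real_inner_self_eq_norm_sq,
      real_inner_comm (ζ s).2 (deriv ζ s).2, Pi.pow_apply]
    field_simp
    push_cast
    ring
  have hnn (s : ℝ) : 0 ≤ ClassS.angularMomentum ζ s := by
    rw [ClassS.angularMomentum]; positivity
  exact (pow_left_inj₀ (hnn a) (hnn b) two_ne_zero).1 key



/-- With E = 0 the velocity is purely spatial, where the metric is positive definite, so a null
velocity would vanish. -/
theorem IsNullGeodesic.energy_ne_zero (h : IsNullGeodesic (S.metric n) (S.carrier n) ζ J)
    {s : ℝ} (hs : s ∈ J) : S.energy ζ s ≠ 0 := by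
  intro h0
  have hg := h.isGeodesic
  have hf := hg.f_pos hs
  have hr := hg.radius_pos hs
  rw [S.energy_eq (hg.mapsTo hs)] at h0
  have ht : (deriv ζ s).1 = 0 := (mul_eq_zero.1 h0).resolve_left hf.ne'
  have hnull := h.null s hs
  rw [S.metric_apply, ht, real_inner_self_eq_norm_sq, mul_zero, mul_zero, zero_add] at hnull
  have h1 : 0 ≤ 1 / S.f (radius (ζ s)) * (dr (ζ s) (deriv ζ s) * dr (ζ s) (deriv ζ s)) :=
    mul_nonneg (by positivity) (mul_self_nonneg _)
  have h2 : 0 ≤ radius (ζ s) ^ 2 * ‖dξ (ζ s) (deriv ζ s)‖ ^ 2 := by positivity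
  have h3 : dr (ζ s) (deriv ζ s) = 0 := by
    have : 1 / S.f (radius (ζ s)) * (dr (ζ s) (deriv ζ s) * dr (ζ s) (deriv ζ s)) = 0 := by linarith
    simpa [hf.ne'] using this
  have h4 : dξ (ζ s) (deriv ζ s) = 0 := by
    have : radius (ζ s) ^ 2 * ‖dξ (ζ s) (deriv ζ s)‖ ^ 2 = 0 := by linarith
    simpa [hr.ne'] using this
  have h5 : (deriv ζ s).2 = 0 := by
    simpa [dξ, h3, hr.ne'] using h4
  exact h.ne_zero s hs (Prod.ext ht h5)

/-- Nullity with t' = E/f and |ξ'| = ℓ/r² inserted: one-dimensional motion in the potential ℓ² f/r².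
-/
theorem IsNullGeodesic.radial_velocity_sq (h : IsNullGeodesic (S.metric n) (S.carrier n) ζ J)
    {s : ℝ} (hs : s ∈ J) :
    dr (ζ s) (deriv ζ s) ^ 2 = S.energy ζ s ^ 2
      - ClassS.angularMomentum ζ s ^ 2 * S.f (radius (ζ s)) / radius (ζ s) ^ 2 := by
  have hg := h.isGeodesic
  have hf := (hg.f_pos hs).ne'
  have hr := (hg.radius_pos hs).ne'
  have hnull := h.null s hs
  rw [S.metric_apply, real_inner_self_eq_norm_sq] at hnull
  rw [S.energy_eq (hg.mapsTo hs), ClassS.angularMomentum]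
  field_simp at hnull ⊢
  linear_combination hnull

/-- The left side is r'', the right side minus half the r-derivative of ℓ² f/r². It comes from the
geodesic equation itself, since differentiating the energy relation would say nothing where r' = 0.
-/
theorem IsNullGeodesic.inner_deriv_deriv (h : IsNullGeodesic (S.metric n) (S.carrier n) ζ J)
    {s : ℝ} (hs : s ∈ J) :
    ⟪(ζ s).2, (deriv (deriv ζ) s).2⟫_ℝ / radius (ζ s)
        + ClassS.angularMomentum ζ s ^ 2 / radius (ζ s) ^ 3
      = S.f (radius (ζ s)) * ClassS.angularMomentum ζ s ^ 2 / radius (ζ s) ^ 3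
        - deriv S.f (radius (ζ s)) * ClassS.angularMomentum ζ s ^ 2 / (2 * radius (ζ s) ^ 2) := by
  have hg := h.isGeodesic
  have hnull := h.null s hs
  rw [S.metric_eq (S.snd_ne_zero (hg.mapsTo hs)), real_inner_self_eq_norm_sq] at hnull
  have h2 := ((S.geodesic_equation_iff (hg.mapsTo hs) _ _).1 (hg.eqn s hs)).2
  refine radial_acceleration_identity (hg.radius_pos hs).ne' (hg.f_pos hs).ne' ?_ hnull
    (S.angularMomentum_sq (hg.mapsTo hs))
  have h3 := congrArg (fun y => ⟪(ζ s).2, y⟫_ℝ) h2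
  simp only [real_inner_smul_right, real_inner_self_eq_norm_sq] at h3
  exact h3

theorem IsNullGeodesic.hasDerivAt_radial_velocity (h : IsNullGeodesic (S.metric n) (S.carrier n) ζ J)
    {s : ℝ} (hs : s ∈ J) :
    HasDerivAt (fun s => dr (ζ s) (deriv ζ s))
      (⟪(ζ s).2, (deriv (deriv ζ) s).2⟫_ℝ / radius (ζ s)
        + ClassS.angularMomentum ζ s ^ 2 / radius (ζ s) ^ 3) s := by
  have hg := h.isGeodesic
  have hr := (hg.radius_pos hs).ne'
  have h1 := ((hg.hasDerivAt_radius hs).inv hr).mul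
    ((hg.hasDerivAt hs).snd_comp.inner ℝ (hg.hasDerivAt_deriv hs).snd_comp)
  refine (h1.congr_of_eventuallyEq (.of_forall fun u => dr_apply _ _)).congr_deriv ?_
  rw [S.angularMomentum_sq (hg.mapsTo hs), dr_apply, real_inner_self_eq_norm_sq]
  simp only [Pi.inv_apply]
  field_simp
  ring

/-- The right hand side of the equation `ρ'' = accel(ρ, ρ')` satisfied by the radius of a symmetric
photon surface as a function of time. -/
def ClassS.accel (S : ClassS) (r p : ℝ) : ℝ :=
  (S.f r ^ 2 - p ^ 2) / r - S.f r * deriv S.f r / 2 + 3 / 2 * deriv S.f r * p ^ 2 / S.f r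

/-- The equation of symmetric photon surfaces. -/
def ClassS.SolvesPhotonODE (S : ClassS) (ρ : ℝ → ℝ) (T : Set ℝ) : Prop :=
  ∀ t ∈ T, deriv (deriv ρ) t = S.accel (ρ t) (deriv ρ t)

/-- The radius of a non-radial null geodesic, as a function of time. -/
theorem IsNullGeodesic.exists_profile
    (h : IsNullGeodesic (S.metric n) (S.carrier n) ζ J) {E ℓ : ℝ} (hE : ∀ s ∈ J, S.energy ζ s = E)
    (hℓ : ∀ s ∈ J, ClassS.angularMomentum ζ s = ℓ) (hpos : 0 < ℓ) :
    ∃ σ : ℝ → ℝ, S.IsProfile σ ((fun s => (ζ s).1) '' J) ∧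
      S.SolvesPhotonODE σ ((fun s => (ζ s).1) '' J) ∧ Set.InjOn (fun s => (ζ s).1) J ∧
      (∀ s ∈ J, σ (ζ s).1 = radius (ζ s)) ∧
      (∀ s ∈ J, deriv σ (ζ s).1 = S.f (radius (ζ s)) / E * dr (ζ s) (deriv ζ s)) ∧
      ∀ s ∈ J, deriv σ (ζ s).1 ^ 2 = S.f (radius (ζ s)) ^ 2
        * (1 - ℓ ^ 2 / E ^ 2 * S.f (radius (ζ s)) / radius (ζ s) ^ 2) := by
  have hg := h.isGeodesic
  obtain ⟨s₁, hs₁⟩ := hg.nonempty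
  have hE0 : E ≠ 0 := hE s₁ hs₁ ▸ h.energy_ne_zero hs₁
  have htder : ∀ s ∈ J, HasDerivAt (fun s => (ζ s).1) (E / S.f (radius (ζ s))) s := by
    intro s hs
    refine (hg.hasDerivAt hs).fst_comp.congr_deriv ?_
    have := (hg.f_pos hs).ne'
    rw [← hE s hs, S.energy_eq (hg.mapsTo hs)]
    field_simp
  -- As t' = E/f has no zero, the geodesic can be reparametrised by time; τ is the affine parameter
  -- at a given time.
  obtain ⟨hTo, hTc, hinj, τ, hτs, hτm, hτl, hτr⟩ := exists_contDiffOn_inverse_of_deriv_ne_zero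
    (h := fun s => (ζ s).1) hg.isOpen hg.ordConnected
    (contDiff_fst.comp_contDiffOn hg.smooth) (fun s hs => by
      rw [(htder s hs).deriv]
      exact div_ne_zero hE0 (hg.f_pos hs).ne')
  obtain ⟨T, hT⟩ : ∃ T, T = (fun s => (ζ s).1) '' J := ⟨_, rfl⟩
  rw [← hT] at hTo hTc hτs hτm hτr ⊢
  have hmT {s : ℝ} (hs : s ∈ J) : (ζ s).1 ∈ T := hT ▸ ⟨s, hs, rfl⟩
  have hτd : ∀ t ∈ T, HasDerivAt τ (S.f (radius (ζ (τ t))) / E) t := by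
    intro t ht
    have h1 := HasDerivAt.of_local_left_inverse
      (hτs.continuousOn.continuousAt (hTo.mem_nhds ht)) (htder _ (hτm ht))
      (div_ne_zero hE0 (hg.f_pos (hτm ht)).ne') (by
        filter_upwards [hTo.mem_nhds ht] with u hu using hτr u hu)
    exact h1.congr_deriv (inv_div _ _)
  have hσd : ∀ t ∈ T, HasDerivAt (fun t => radius (ζ (τ t)))
      (S.f (radius (ζ (τ t))) / E * dr (ζ (τ t)) (deriv ζ (τ t))) t := fun t ht =>
    ((hg.hasDerivAt_radius (hτm ht)).comp t (hτd t ht)).congr_deriv (mul_comm _ _)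
  have hσsq : ∀ t ∈ T, (S.f (radius (ζ (τ t))) / E * dr (ζ (τ t)) (deriv ζ (τ t))) ^ 2
      = S.f (radius (ζ (τ t))) ^ 2
        * (1 - ℓ ^ 2 / E ^ 2 * S.f (radius (ζ (τ t))) / radius (ζ (τ t)) ^ 2) := by
    intro t ht
    rw [mul_pow, h.radial_velocity_sq (hτm ht), hE _ (hτm ht), hℓ _ (hτm ht)]
    field_simp
  refine ⟨fun t => radius (ζ (τ t)), ⟨hTo, hTc, ⟨_, hmT hs₁⟩, ?_, fun t ht => hg.mapsTo (hτm ht),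
    fun t ht => ?_⟩, fun t ht => ?_, hinj, fun s hs => ?_, fun s hs => ?_, fun s hs => ?_⟩
  · have : ContDiffOn ℝ ∞ (radius (n := n)) (S.carrier n) :=
      (contDiffOn_snd).norm ℝ fun q hq => S.snd_ne_zero hq
    exact this.comp (hg.smooth.comp hτs hτm) fun t ht => hg.mapsTo (hτm ht)
  · rw [(hσd t ht).deriv, hσsq t ht]
    have hf := hg.f_pos (hτm ht)
    have hr := hg.radius_pos (hτm ht)
    -- Positive angular momentum makes the slope bound strict.
    have h1 : 0 < ℓ ^ 2 / E ^ 2 * S.f (radius (ζ (τ t))) / radius (ζ (τ t)) ^ 2 := by positivity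
    have h2 : 0 < S.f (radius (ζ (τ t))) ^ 2 := by positivity
    nlinarith
  · have hf := (hg.f_pos (hτm ht)).ne'
    have hr := (hg.radius_pos (hτm ht)).ne'
    have e : deriv (fun t => radius (ζ (τ t))) =ᶠ[𝓝 t]
        fun t => S.f (radius (ζ (τ t))) / E * dr (ζ (τ t)) (deriv ζ (τ t)) := by
      filter_upwards [hTo.mem_nhds ht] with u hu using (hσd u hu).deriv
    have h1 := ((((S.differentiableAt_f (hg.mapsTo (hτm ht))).hasDerivAt.comp t (hσd t ht)).div_const
      E).mul ((h.hasDerivAt_radial_velocity (hτm ht)).comp t (hτd t ht)))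
    have h1' : HasDerivAt (fun t => S.f (radius (ζ (τ t))) / E * dr (ζ (τ t)) (deriv ζ (τ t))) _ t :=
      h1
    have hv := h.radial_velocity_sq (hτm ht)
    rw [hE _ (hτm ht), hℓ _ (hτm ht)] at hv
    rw [e.deriv_eq, h1'.deriv, (hσd t ht).deriv, h.inner_deriv_deriv (hτm ht), hℓ _ (hτm ht),
      ClassS.accel]
    simp only [Function.comp]
    generalize dr (ζ (τ t)) (deriv ζ (τ t)) = w at *
    -- Substituting this value of ℓ² also makes E cancel, which leaves an autonomous equation in ρ
    -- and ρ'.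
    have hv' : ℓ ^ 2 = (E ^ 2 - w ^ 2) * radius (ζ (τ t)) ^ 2 / S.f (radius (ζ (τ t))) := by
      rw [hv]
      field_simp
      ring
    rw [hv']
    field_simp
    ring
  · simp only [hτl s hs]
  · rw [(hσd _ (hmT hs)).deriv, hτl s hs]
  · rw [(hσd _ (hmT hs)).deriv, hσsq _ (hmT hs), hτl s hs]

end PhotonSurfaces

/-! ### The photon surface equation: uniqueness, existence, first integral, and the geodesics it
carries. -/

namespace PhotonSurfaces

variable {n : ℕ} {S : ClassS} {ρ σ : ℝ → ℝ} {T T' : Set ℝ}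

/-- The vector field on the `(r, r')`-plane which belongs to the equation of symmetric photon
surfaces. -/
def ClassS.photonField (S : ClassS) (y : ℝ × ℝ) : ℝ × ℝ := (y.2, S.accel y.1 y.2)

theorem ClassS.contDiffOn_photonField : ContDiffOn ℝ ∞ S.photonField (Prod.fst ⁻¹' S.I) := by
  have hf : ContDiffOn ℝ ∞ (fun y : ℝ × ℝ => S.f y.1) (Prod.fst ⁻¹' S.I) :=
    S.smooth.comp contDiffOn_fst fun y hy => hy
  have hf' : ContDiffOn ℝ ∞ (fun y : ℝ × ℝ => deriv S.f y.1) (Prod.fst ⁻¹' S.I) :=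
    ((contDiffOn_infty_iff_deriv_of_isOpen S.isOpen).1 S.smooth).2.comp contDiffOn_fst
      fun y hy => hy
  have h1 : ContDiffOn ℝ ∞ (fun y : ℝ × ℝ => y.1) (Prod.fst ⁻¹' S.I) := contDiffOn_fst
  have h2 : ContDiffOn ℝ ∞ (fun y : ℝ × ℝ => y.2) (Prod.fst ⁻¹' S.I) := contDiffOn_snd
  refine h2.prodMk ((ContDiffOn.sub ?_ ?_).add ?_)
  · exact ((hf.pow 2).sub (h2.pow 2)).div h1 fun y hy => (S.pos hy).ne'
  · exact (hf.mul hf').div_const 2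
  · exact ((contDiffOn_const.mul hf').mul (h2.pow 2)).div hf fun y hy => (S.f_pos _ hy).ne'

theorem ClassS.contDiffAt_photonField {y : ℝ × ℝ} (hy : y.1 ∈ S.I) :
    ContDiffAt ℝ ∞ S.photonField y :=
  S.contDiffOn_photonField.contDiffAt ((S.isOpen.preimage continuous_fst).mem_nhds hy)

theorem ClassS.SolvesPhotonODE.hasDerivAt_photonField (hode : S.SolvesPhotonODE ρ T)
    (h : S.IsProfile ρ T) {t : ℝ} (ht : t ∈ T) :
    HasDerivAt (fun t => (ρ t, deriv ρ t)) (S.photonField (ρ t, deriv ρ t)) t := by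
  refine (h.hasDerivAt ht).prodMk ?_
  have := h.hasDerivAt_deriv ht
  rwa [hode t ht] at this

/-- As a first-order system in (ρ, ρ') the equation has a locally Lipschitz right side, so
Picard–Lindelöf uniqueness applies even at turning points. -/
theorem ClassS.SolvesPhotonODE.eventuallyEq (hρ : S.SolvesPhotonODE ρ T) (h : S.IsProfile ρ T)
    (hσ : S.SolvesPhotonODE σ T') (h' : S.IsProfile σ T') {t₀ : ℝ} (ht : t₀ ∈ T) (ht' : t₀ ∈ T')
    (h0 : ρ t₀ = σ t₀) (h1 : deriv ρ t₀ = deriv σ t₀) : ρ =ᶠ[𝓝 t₀] σ := by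
  obtain ⟨K, U, hU, hlip⟩ := ((S.contDiffAt_photonField (y := (ρ t₀, deriv ρ t₀))
    (h.mapsTo ht)).of_le (m := 1) (by simp)).exists_lipschitzOnWith
  have key {ρ' : ℝ → ℝ} {R : Set ℝ} (hode : S.SolvesPhotonODE ρ' R) (hp : S.IsProfile ρ' R)
      (hR : t₀ ∈ R) (hy : (ρ t₀, deriv ρ t₀) = (ρ' t₀, deriv ρ' t₀)) :
      ∀ᶠ t in 𝓝 t₀, HasDerivAt (fun t => (ρ' t, deriv ρ' t))
        (S.photonField (ρ' t, deriv ρ' t)) t ∧ (ρ' t, deriv ρ' t) ∈ U := by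
    have hc : ContinuousAt (fun t => (ρ' t, deriv ρ' t)) t₀ :=
      (hode.hasDerivAt_photonField hp hR).continuousAt
    filter_upwards [hp.isOpen.mem_nhds hR, hc.eventually (hy ▸ hU)] with t h1 h2
    exact ⟨hode.hasDerivAt_photonField hp h1, h2⟩
  have hy : (ρ t₀, deriv ρ t₀) = (σ t₀, deriv σ t₀) := by rw [h0, h1]
  have := ODE_solution_unique_of_eventually (v := fun _ => S.photonField) (s := fun _ => U)
    (.of_forall fun _ => hlip) (key hρ h ht rfl) (key hσ h' ht' hy) hy
  filter_upwards [this] with t ht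
  exact congrArg Prod.fst ht

/-- Picard–Lindelöf, on an interval shrunk so that by continuity the radius stays in I and the graph
stays timelike. -/
theorem ClassS.exists_solvesPhotonODE (S : ClassS) {r₀ p₀ : ℝ} (hr : r₀ ∈ S.I)
    (hp : p₀ ^ 2 < S.f r₀ ^ 2) (t₀ : ℝ) :
    ∃ (σ : ℝ → ℝ) (T : Set ℝ), S.IsProfile σ T ∧ S.SolvesPhotonODE σ T ∧ t₀ ∈ T ∧ σ t₀ = r₀ ∧
      deriv σ t₀ = p₀ := by
  obtain ⟨α, hα0, ε, hε, hα⟩ := ((S.contDiffAt_photonField (y := (r₀, p₀)) hr).of_le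
    (m := 1) (by simp)).exists_forall_mem_closedBall_exists_eq_forall_mem_Ioo_hasDerivAt₀ t₀
  have ht0 : t₀ ∈ Set.Ioo (t₀ - ε) (t₀ + ε) := ⟨by linarith, by linarith⟩
  have hαc : ContinuousAt α t₀ := (hα t₀ ht0).continuousAt
  have hopen : IsOpen ({y : ℝ × ℝ | y.1 ∈ S.I}) := S.isOpen.preimage continuous_fst
  have e1 : ∀ᶠ t in 𝓝 t₀, (α t).1 ∈ S.I :=
    hαc.eventually (hopen.mem_nhds (by rw [hα0]; exact hr))
  have e2 : ∀ᶠ t in 𝓝 t₀, (α t).2 ^ 2 < S.f (α t).1 ^ 2 := by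
    have c1 : ContinuousAt (fun t => (α t).1) t₀ := continuousAt_fst.comp hαc
    have c2 : ContinuousAt (fun t => (α t).2) t₀ := continuousAt_snd.comp hαc
    have c3 : ContinuousAt (fun t => S.f (α t).1) t₀ :=
      ContinuousAt.comp (g := S.f) (S.differentiableAt_f (by rw [hα0]; exact hr)).continuousAt c1
    exact (c2.pow 2).eventually_lt (c3.pow 2) (by simpa [hα0] using hp)
  obtain ⟨δ, hδ, hball⟩ := Metric.eventually_nhds_iff_ball.1
    ((e1.and e2).and (Ioo_mem_nhds ht0.1 ht0.2))
  rw [Real.ball_eq_Ioo] at hball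
  obtain ⟨T, hT⟩ : ∃ T, T = Set.Ioo (t₀ - δ) (t₀ + δ) := ⟨_, rfl⟩
  rw [← hT] at hball
  have hTo : IsOpen T := hT ▸ isOpen_Ioo
  have htT : t₀ ∈ T := hT ▸ ⟨by linarith, by linarith⟩
  have hαd : ∀ t ∈ T, HasDerivAt α (S.photonField (α t)) t := fun t ht => hα t (hball t ht).2
  -- Bootstrapping: α' is a smooth field composed with α, so each order of smoothness gives the
  -- next.
  have hsmooth : ContDiffOn ℝ ∞ α T := by
    rw [contDiffOn_infty]
    intro k
    induction k with
    | zero =>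
      exact contDiffOn_zero.2 fun t ht => (hαd t ht).continuousAt.continuousWithinAt
    | succ k ih =>
      rw [Nat.cast_succ, contDiffOn_succ_iff_deriv_of_isOpen hTo]
      refine ⟨fun t ht => (hαd t ht).differentiableAt.differentiableWithinAt, by simp, ?_⟩
      refine ContDiffOn.congr ?_ fun t ht => (hαd t ht).deriv
      exact (contDiffOn_infty.1 S.contDiffOn_photonField k).comp ih fun t ht => (hball t ht).1.1
  have hd1 : ∀ t ∈ T, HasDerivAt (fun t => (α t).1) (α t).2 t := fun t ht =>
    (hasFDerivAt_fst (𝕜 := ℝ) (p := α t)).comp_hasDerivAt t (hαd t ht)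
  have hd2 : ∀ t ∈ T, HasDerivAt (fun t => (α t).2) (S.accel (α t).1 (α t).2) t := fun t ht =>
    (hasFDerivAt_snd (𝕜 := ℝ) (p := α t)).comp_hasDerivAt t (hαd t ht)
  refine ⟨fun t => (α t).1, T, ⟨hTo, hT ▸ Set.ordConnected_Ioo, ⟨t₀, htT⟩,
    contDiff_fst.comp_contDiffOn hsmooth, fun t ht => (hball t ht).1.1, fun t ht => ?_⟩,
    fun t ht => ?_, htT, congrArg Prod.fst hα0, ?_⟩
  · rw [(hd1 t ht).deriv]
    exact (hball t ht).1.2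
  · have e : deriv (fun t => (α t).1) =ᶠ[𝓝 t] fun t => (α t).2 := by
      filter_upwards [hTo.mem_nhds ht] with u hu using (hd1 u hu).deriv
    rw [e.deriv_eq, (hd2 t ht).deriv, (hd1 t ht).deriv]
  · rw [(hd1 t₀ htT).deriv, hα0]

/-- The first integral of the equation of symmetric photon surfaces. -/
theorem ClassS.SolvesPhotonODE.exists_first_integral (hode : S.SolvesPhotonODE ρ T)
    (h : S.IsProfile ρ T) :
    ∃ κ > 0, ∀ t ∈ T, deriv ρ t ^ 2 = S.f (ρ t) ^ 2 * (1 - κ ^ 2 * S.f (ρ t) / ρ t ^ 2) := by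
  obtain ⟨t₀, ht₀⟩ := h.nonempty
  -- The quantity is the expression for ℓ²/E² obtained by solving the squared-slope relation of null
  -- geodesics.
  have hconst : ∀ t ∈ T, (S.f (ρ t) ^ 2 - deriv ρ t ^ 2) * ρ t ^ 2 / S.f (ρ t) ^ 3
      = (S.f (ρ t₀) ^ 2 - deriv ρ t₀ ^ 2) * ρ t₀ ^ 2 / S.f (ρ t₀) ^ 3 := by
    intro t ht
    refine eq_of_hasDerivAt_zero_on_interval
      (h := fun t => (S.f (ρ t) ^ 2 - deriv ρ t ^ 2) * ρ t ^ 2 / S.f (ρ t) ^ 3)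
      h.ordConnected (fun t ht => ?_) ht ht₀
    have hf := (h.f_pos ht).ne'
    have hr := (h.pos ht).ne'
    have hfd := (S.differentiableAt_f (h.mapsTo ht)).hasDerivAt.comp t (h.hasDerivAt ht)
    have h1 := (((hfd.pow 2).sub ((h.hasDerivAt_deriv ht).pow 2)).mul
      ((h.hasDerivAt ht).pow 2)).div (hfd.pow 3) (pow_ne_zero 3 hf)
    refine h1.congr_deriv ?_
    rw [hode t ht, ClassS.accel]
    simp only [Function.comp, Pi.mul_apply, Pi.sub_apply, Pi.pow_apply]
    field_simp
    push_cast
    ring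
  have hpos : 0 < (S.f (ρ t₀) ^ 2 - deriv ρ t₀ ^ 2) * ρ t₀ ^ 2 / S.f (ρ t₀) ^ 3 := by
    have h1 := sub_pos.2 (h.slope _ ht₀)
    have h2 := h.f_pos ht₀
    have h3 := h.pos ht₀
    positivity
  refine ⟨√((S.f (ρ t₀) ^ 2 - deriv ρ t₀ ^ 2) * ρ t₀ ^ 2 / S.f (ρ t₀) ^ 3), Real.sqrt_pos.2 hpos,
    fun t ht => ?_⟩
  rw [Real.sq_sqrt hpos.le, ← hconst t ht]
  have hf := (h.f_pos ht).ne'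
  have hr := (h.pos ht).ne'
  field_simp
  ring

/-- Given a solution `ρ` of the equation of symmetric photon surfaces, a null geodesic generating
its rotation. -/
theorem ClassS.SolvesPhotonODE.exists_geodesic (hode : S.SolvesPhotonODE ρ T)
    (h : S.IsProfile ρ T) {E ℓ : ℝ} (hE : E ≠ 0)
    (hint : ∀ t ∈ T, deriv ρ t ^ 2 = S.f (ρ t) ^ 2 * (1 - ℓ ^ 2 / E ^ 2 * S.f (ρ t) / ρ t ^ 2))
    {e₁ e₂ : EuclideanSpace ℝ (Fin n)} (he₁ : ‖e₁‖ = 1) (he₂ : ‖e₂‖ = 1) (he : ⟪e₁, e₂⟫_ℝ = 0)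
    {t₀ : ℝ} (ht₀ : t₀ ∈ T) (s₀ : ℝ) :
    ∃ (A ψ : ℝ → ℝ) (ζ : ℝ → Pt n), A t₀ = s₀ ∧ ψ t₀ = 0 ∧
      (∀ t ∈ T, HasDerivAt A (S.f (ρ t) / E) t) ∧
      (∀ t ∈ T, HasDerivAt ψ (ℓ / ρ t ^ 2 * (S.f (ρ t) / E)) t) ∧
      IsNullGeodesic (S.metric n) (S.carrier n) ζ (A '' T) ∧
      ∀ t ∈ T, ζ (A t) = (t, ρ t • (Real.cos (ψ t) • e₁ + Real.sin (ψ t) • e₂)) := by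
  have hfρ : ContDiffOn ℝ ∞ (fun t => S.f (ρ t)) T := S.smooth.comp h.smooth h.mapsTo
  -- A is the affine parameter as a function of time, from E = f t'; below, ψ is the angle along a
  -- great circle, from ℓ = r² dφ/ds.
  obtain ⟨A, hA0, hAd, hAs⟩ := exists_contDiffOn_antiderivative (g := fun t => S.f (ρ t) / E)
    h.isOpen h.ordConnected (hfρ.div_const E) ht₀ s₀
  obtain ⟨ψ, hψ0, hψd, hψs⟩ := exists_contDiffOn_antiderivative
    (g := fun t => ℓ / ρ t ^ 2 * (S.f (ρ t) / E)) h.isOpen h.ordConnected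
    ((contDiffOn_const.div (h.smooth.pow 2) fun t ht => pow_ne_zero 2 (h.pos ht).ne').mul
      (hfρ.div_const E)) ht₀ 0
  obtain ⟨hJo, hJc, hinj, τ, hτs, hτm, hτl, hτr⟩ := exists_contDiffOn_inverse_of_deriv_ne_zero
    h.isOpen h.ordConnected hAs (fun t ht => by
      rw [(hAd t ht).deriv]
      exact div_ne_zero (h.f_pos ht).ne' hE)
  obtain ⟨J, hJ⟩ : ∃ J, J = A '' T := ⟨_, rfl⟩
  rw [← hJ] at hJo hJc hτs hτm hτr
  have hτd : ∀ s ∈ J, HasDerivAt τ (E / S.f (ρ (τ s))) s := by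
    intro s hs
    have h1 := HasDerivAt.of_local_left_inverse
      (hτs.continuousOn.continuousAt (hJo.mem_nhds hs)) (hAd _ (hτm hs))
      (div_ne_zero (h.f_pos (hτm hs)).ne' hE) (by
        filter_upwards [hJo.mem_nhds hs] with u hu using hτr u hu)
    exact h1.congr_deriv (inv_div _ _)
  let c : ℝ → EuclideanSpace ℝ (Fin n) := fun φ => Real.cos φ • e₁ + Real.sin φ • e₂
  let d : ℝ → EuclideanSpace ℝ (Fin n) := fun φ => -Real.sin φ • e₁ + Real.cos φ • e₂
  have hc (φ : ℝ) : HasDerivAt c (d φ) φ :=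
    ((Real.hasDerivAt_cos φ).smul_const e₁).add ((Real.hasDerivAt_sin φ).smul_const e₂)
  have hd (φ : ℝ) : HasDerivAt d (-c φ) φ := by
    refine (((Real.hasDerivAt_sin φ).neg.smul_const e₁).add
      ((Real.hasDerivAt_cos φ).smul_const e₂)).congr_deriv ?_
    simp only [c]
    module
  have he' : ⟪e₂, e₁⟫_ℝ = 0 := by rw [real_inner_comm, he]
  have he11 : ⟪e₁, e₁⟫_ℝ = 1 := by rw [real_inner_self_eq_norm_sq, he₁, one_pow]
  have he22 : ⟪e₂, e₂⟫_ℝ = 1 := by rw [real_inner_self_eq_norm_sq, he₂, one_pow]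
  have hcc (φ : ℝ) : ⟪c φ, c φ⟫_ℝ = 1 := by
    simp only [c, inner_add_left, inner_add_right, real_inner_smul_left, real_inner_smul_right,
      he11, he22, he, he']
    linear_combination Real.cos_sq_add_sin_sq φ
  have hdd (φ : ℝ) : ⟪d φ, d φ⟫_ℝ = 1 := by
    simp only [d, inner_add_left, inner_add_right, real_inner_smul_left, real_inner_smul_right,
      he11, he22, he, he']
    linear_combination Real.cos_sq_add_sin_sq φ
  have hcd (φ : ℝ) : ⟪c φ, d φ⟫_ℝ = 0 := by
    simp only [c, d, inner_add_left, inner_add_right, real_inner_smul_left, real_inner_smul_right,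
      he11, he22, he, he']
    ring
  let r : ℝ → ℝ := fun s => ρ (τ s)
  -- w is the radial velocity dr/ds; in terms of w the hypothesis `hint` becomes the energy relation
  -- `hw2`.
  let w : ℝ → ℝ := fun s => deriv ρ (τ s) * (E / S.f (ρ (τ s)))
  let φ : ℝ → ℝ := fun s => ψ (τ s)
  have hrd : ∀ s ∈ J, HasDerivAt r (w s) s := fun s hs => (h.hasDerivAt (hτm hs)).comp s (hτd s hs)
  have hφd : ∀ s ∈ J, HasDerivAt φ (ℓ / r s ^ 2) s := by
    intro s hs
    refine ((hψd _ (hτm hs)).comp s (hτd s hs)).congr_deriv ?_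
    have hf := (h.f_pos (hτm hs)).ne'
    have hr := (h.pos (hτm hs)).ne'
    simp only [r]
    field_simp
  have hfd : ∀ s ∈ J, HasDerivAt (fun s => S.f (r s)) (deriv S.f (r s) * w s) s := fun s hs =>
    (S.differentiableAt_f (h.mapsTo (hτm hs))).hasDerivAt.comp s (hrd s hs)
  have hw2 : ∀ s ∈ J, w s ^ 2 = E ^ 2 - ℓ ^ 2 * S.f (r s) / r s ^ 2 := by
    intro s hs
    have hf := (h.f_pos (hτm hs)).ne'
    have hr := (h.pos (hτm hs)).ne'
    simp only [w, r]
    rw [mul_pow, hint _ (hτm hs)]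
    field_simp
  have hwd : ∀ s ∈ J, HasDerivAt w
      (S.f (r s) * ℓ ^ 2 / r s ^ 3 - deriv S.f (r s) * ℓ ^ 2 / (2 * r s ^ 2)) s := by
    intro s hs
    have hf : S.f (r s) ≠ 0 := (h.f_pos (hτm hs)).ne'
    have hr : r s ≠ 0 := (h.pos (hτm hs)).ne'
    refine (((h.hasDerivAt_deriv (hτm hs)).comp s (hτd s hs)).mul
      ((hasDerivAt_const s E).div (hfd s hs) hf)).congr_deriv ?_
    have h1 : deriv ρ (τ s) = w s * S.f (r s) / E := by
      have hf' : S.f (ρ (τ s)) ≠ 0 := hf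
      simp only [w, r]
      field_simp
    have h2 : ℓ ^ 2 = (E ^ 2 - w s ^ 2) * r s ^ 2 / S.f (r s) := by
      rw [hw2 s hs]
      field_simp
      ring
    rw [hode _ (hτm hs), ClassS.accel]
    change S.accel (r s) (deriv ρ (τ s)) * (E / S.f (r s)) * (E / S.f (r s))
      + deriv ρ (τ s) * ((0 * S.f (r s) - E * (deriv S.f (r s) * w s)) / S.f (r s) ^ 2) = _
    rw [ClassS.accel, h1, h2]
    field_simp
    ring
  have hrpos : ∀ s ∈ J, 0 < r s := fun s hs => h.pos (hτm hs)
  have hfpos : ∀ s ∈ J, 0 < S.f (r s) := fun s hs => h.f_pos (hτm hs)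
  let ζ : ℝ → Pt n := fun s => (τ s, r s • c (φ s))
  have hrad : ∀ s ∈ J, radius (ζ s) = r s := by
    intro s hs
    have h1 : ‖c (φ s)‖ = 1 := by
      have := hcc (φ s)
      rw [real_inner_self_eq_norm_sq] at this
      exact (pow_eq_one_iff_of_nonneg (norm_nonneg _) two_ne_zero).1 this
    simp [ζ, radius, norm_smul, h1, abs_of_pos (hrpos s hs)]
  have hmem : Set.MapsTo ζ J (S.carrier n) := by
    intro s hs
    change radius (ζ s) ∈ S.I
    rw [hrad s hs]
    exact h.mapsTo (hτm hs)
  let v : ℝ → Pt n := fun s => (E / S.f (r s), w s • c (φ s) + (ℓ / r s) • d (φ s))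
  have hζd : ∀ s ∈ J, HasDerivAt ζ (v s) s := by
    intro s hs
    refine (hτd s hs).prodMk (((hrd s hs).smul ((hc _).scomp s (hφd s hs))).congr_deriv ?_)
    have hr := (hrpos s hs).ne'
    simp only [Function.comp, smul_smul]
    rw [add_comm]
    congr 2
    field_simp
  let a : ℝ → Pt n := fun s => (-E * (deriv S.f (r s) * w s) / S.f (r s) ^ 2,
    (S.f (r s) * ℓ ^ 2 / r s ^ 3 - deriv S.f (r s) * ℓ ^ 2 / (2 * r s ^ 2) - ℓ ^ 2 / r s ^ 3)
      • c (φ s))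
  have hvd : ∀ s ∈ J, HasDerivAt v (a s) s := by
    intro s hs
    have hr := (hrpos s hs).ne'
    refine (((hasDerivAt_const s E).div (hfd s hs) (hfpos s hs).ne').congr_deriv
      (by ring)).prodMk ((((hwd s hs).smul ((hc _).scomp s (hφd s hs))).add
        (((hasDerivAt_const s ℓ).div (hrd s hs) hr).smul ((hd _).scomp s (hφd s hs)))).congr_deriv ?_)
    simp only [Function.comp, Pi.div_apply]
    match_scalars
    · field_simp
      ring
    · field_simp
      ring
  have hderiv : ∀ s ∈ J, deriv ζ s = v s := fun s hs => (hζd s hs).deriv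
  have hderiv2 : ∀ s ∈ J, deriv (deriv ζ) s = a s := by
    intro s hs
    have e : deriv ζ =ᶠ[𝓝 s] v := by
      filter_upwards [hJo.mem_nhds hs] with u hu using hderiv u hu
    rw [e.deriv_eq, (hvd s hs).deriv]
  have hsmooth : ContDiffOn ℝ ∞ ζ J := by
    have h1 : ContDiffOn ℝ ∞ φ J := hψs.comp hτs hτm
    have h2 : ContDiffOn ℝ ∞ r J := h.smooth.comp hτs hτm
    exact hτs.prodMk (h2.smul (((Real.contDiff_cos.comp_contDiffOn h1).smul contDiffOn_const).add
      ((Real.contDiff_sin.comp_contDiffOn h1).smul contDiffOn_const)))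
  have hζ2 (s : ℝ) : (ζ s).2 = r s • c (φ s) := rfl
  have hxv (s : ℝ) : ⟪(ζ s).2, (v s).2⟫_ℝ = r s * w s := by
    simp only [hζ2, v, inner_add_right, real_inner_smul_left, real_inner_smul_right, hcc, hcd]
    ring
  have hvv (s : ℝ) : ⟪(v s).2, (v s).2⟫_ℝ = w s ^ 2 + (ℓ / r s) ^ 2 := by
    simp only [v, inner_add_left, inner_add_right, real_inner_smul_left, real_inner_smul_right,
      hcc, hcd, hdd, real_inner_comm (c _) (d _)]
    ring
  refine ⟨A, ψ, ζ, hA0, hψ0, hAd, hψd, ?_, fun t ht => ?_⟩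
  · rw [← hJ]
    refine ⟨⟨hJo, hJc, hJ ▸ (h.nonempty.image A), hsmooth, hmem, fun s hs => ?_⟩,
      fun s hs => ?_, fun s hs h0 => ?_⟩
    · have hr := (hrpos s hs).ne'
      have hf := (hfpos s hs).ne'
      rw [S.geodesic_equation_iff (hmem hs), hderiv s hs, hderiv2 s hs, hrad s hs, hxv,
        ← real_inner_self_eq_norm_sq, hvv]
      constructor
      · simp only [a, v]
        field_simp
        ring
      · have hxa : ⟪(ζ s).2, (a s).2⟫_ℝ = r s * (S.f (r s) * ℓ ^ 2 / r s ^ 3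
            - deriv S.f (r s) * ℓ ^ 2 / (2 * r s ^ 2) - ℓ ^ 2 / r s ^ 3) := by
          simp only [hζ2, a, real_inner_smul_left, real_inner_smul_right, hcc]
          ring
        rw [hxa, hζ2, smul_smul]
        simp only [a, v]
        congr 1
        rw [mul_pow (r s) (w s), hw2 s hs, ClassS.warp, ClassS.warpDeriv]
        field_simp
        ring
    · have hr := (hrpos s hs).ne'
      have hf := (hfpos s hs).ne'
      rw [hderiv s hs, S.metric_eq (S.snd_ne_zero (hmem hs)), hrad s hs, hxv, hvv, ← sq (r s * w s),
        mul_pow (r s) (w s), hw2 s hs, ClassS.warp]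
      simp only [v]
      field_simp
      ring
    · rw [hderiv s hs] at h0
      exact div_ne_zero hE (hfpos s hs).ne' (congrArg Prod.fst h0)
  · simp only [ζ, r, φ, c, hτl t ht]

end PhotonSurfaces

/-! ### Generated surfaces, photon surfaces and umbilicity in terms of the equation. -/

namespace PhotonSurfaces

theorem deriv_mem_tangentSet {V : Type*} [NormedAddCommGroup V] [NormedSpace ℝ V] {H : Set V}
    {ζ : ℝ → V} {s : ℝ} (hd : DifferentiableAt ℝ ζ s) (hH : ∀ᶠ u in 𝓝 s, ζ u ∈ H) :
    deriv ζ s ∈ tangentSet H (ζ s) := by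
  have hc : Filter.Tendsto (fun u : ℝ => s + u) (𝓝 0) (𝓝 s) := by
    have : ContinuousAt (fun u : ℝ => s + u) 0 := by fun_prop
    simpa [ContinuousAt] using this
  refine ⟨fun u => ζ (s + u), by simp, ?_, hc.eventually hH⟩
  have h1 : HasDerivAt ζ (deriv ζ s) (s + 0) := by rw [add_zero]; exact hd.hasDerivAt
  exact h1.comp_const_add s 0

variable {n : ℕ} {S : ClassS} {ρ σ : ℝ → ℝ} {T T' J : Set ℝ} {ζ : ℝ → Pt n}

theorem exists_orthonormal_pair (hn : 2 ≤ n) :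
    ∃ e₁ e₂ : EuclideanSpace ℝ (Fin n), ‖e₁‖ = 1 ∧ ‖e₂‖ = 1 ∧ ⟪e₁, e₂⟫_ℝ = 0 := by
  refine ⟨EuclideanSpace.single ⟨0, by omega⟩ 1, EuclideanSpace.single ⟨1, by omega⟩ 1,
    by simp, by simp, ?_⟩
  simp [EuclideanSpace.inner_single_left]

theorem norm_cos_smul_add_sin_smul {e₁ e₂ : EuclideanSpace ℝ (Fin n)} (he₁ : ‖e₁‖ = 1)
    (he₂ : ‖e₂‖ = 1) (he : ⟪e₁, e₂⟫_ℝ = 0) (φ : ℝ) :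
    ‖Real.cos φ • e₁ + Real.sin φ • e₂‖ = 1 := by
  refine (pow_eq_one_iff_of_nonneg (norm_nonneg _) two_ne_zero).1 ?_
  rw [norm_add_sq_real, norm_smul, norm_smul, real_inner_smul_left, real_inner_smul_right, he, he₁,
    he₂, mul_one, mul_one, Real.norm_eq_abs, Real.norm_eq_abs, sq_abs, sq_abs]
  linear_combination Real.cos_sq_add_sin_sq φ

namespace ClassS

/-- The time interval of a profile is determined by its rotation. -/
theorem IsProfile.fst_image (h : S.IsProfile ρ T) (hn : 2 ≤ n) :
    Prod.fst '' rotSurface n ρ T = T := by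
  obtain ⟨e₁, -, he₁, -⟩ := exists_orthonormal_pair hn
  ext t
  exact ⟨fun ⟨p, hp, hpt⟩ => hpt ▸ hp.1, fun ht => ⟨_, h.mem_rotSurface_smul ht he₁, rfl⟩⟩

theorem IsProfile.orbit_eq (h : S.IsProfile ρ T) (himg : (fun s => (ζ s).1) '' J = T)
    (hrad : ∀ s ∈ J, ρ (ζ s).1 = radius (ζ s)) : orbit ζ J = rotSurface n ρ T := by
  ext p
  constructor
  · rintro ⟨s, hs, ξ, hξ, hp1, hp2⟩
    have hp1' : p.1 = (ζ s).1 := hp1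
    have ht : (ζ s).1 ∈ T := himg ▸ ⟨s, hs, rfl⟩
    refine ⟨by rwa [hp1'], ?_⟩
    rw [hp2, hp1', hrad s hs, norm_smul, mem_sphere_zero_iff_norm.1 hξ, mul_one, ← hrad s hs,
      Real.norm_of_nonneg (h.pos ht).le]
  · intro hp
    have hp1 := hp.1
    rw [← himg] at hp1
    obtain ⟨s, hs, hst⟩ := hp1
    have hst' : (ζ s).1 = p.1 := hst
    have hp2 : ‖p.2‖ ≠ 0 := by simpa using S.snd_ne_zero (h.mem_carrier hp)
    refine ⟨s, hs, ‖p.2‖⁻¹ • p.2, by simp [norm_smul, hp2], hst'.symm, ?_⟩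
    rw [← hrad s hs, hst', ← hp.2, smul_smul, mul_inv_cancel₀ hp2, one_smul]

/-- The slope of the profile of a symmetric hypersurface tangent to a null geodesic. -/
theorem IsProfile.deriv_sq_of_tangent (h : S.IsProfile ρ T)
    (hζ : IsNullGeodesic (S.metric n) (S.carrier n) ζ J) {s : ℝ} (hs : s ∈ J)
    (hmem : ζ s ∈ rotSurface n ρ T) (htan : deriv ζ s ∈ tangentSet (rotSurface n ρ T) (ζ s)) :
    0 < angularMomentum ζ s ∧ dr (ζ s) (deriv ζ s) = deriv ρ (ζ s).1 * (deriv ζ s).1 ∧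
    deriv ρ (ζ s).1 ^ 2 = S.f (ρ (ζ s).1) ^ 2
      * (1 - angularMomentum ζ s ^ 2 / S.energy ζ s ^ 2 * S.f (ρ (ζ s).1) / ρ (ζ s).1 ^ 2) := by
  have hg := hζ.isGeodesic
  have hE := hζ.energy_ne_zero hs
  have hrad : radius (ζ s) = ρ (ζ s).1 := hmem.2
  have hr := h.pos hmem.1
  have hf := h.f_pos hmem.1
  have hdr : dr (ζ s) (deriv ζ s) = deriv ρ (ζ s).1 * (deriv ζ s).1 := by
    rw [dr_apply, (h.mem_tangentSet_iff hmem _).1 htan, hrad]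
    field_simp
  have hvel := hζ.radial_velocity_sq hs
  have hEeq := S.energy_eq (hg.mapsTo hs)
  rw [hrad] at hvel hEeq
  have hv : (deriv ζ s).1 = S.energy ζ s / S.f (ρ (ζ s).1) := by
    rw [hEeq]
    field_simp
  rw [hdr, hv] at hvel
  have hsq : deriv ρ (ζ s).1 ^ 2 = S.f (ρ (ζ s).1) ^ 2
      * (1 - angularMomentum ζ s ^ 2 / S.energy ζ s ^ 2 * S.f (ρ (ζ s).1) / ρ (ζ s).1 ^ 2) := by
    field_simp at hvel ⊢
    linear_combination hvel
  refine ⟨?_, hdr, hsq⟩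
  have hnn : 0 ≤ angularMomentum ζ s := by rw [angularMomentum]; positivity
  -- With ℓ = 0 the slope would be that of a radial null curve, ρ'² = f², against timelikeness.
  refine lt_of_le_of_ne hnn fun h0 => ?_
  have := h.slope _ hmem.1
  rw [hsq, ← h0] at this
  simp at this

/-- A hypersurface generated by a null geodesic solves the equation of symmetric photon surfaces. -/
theorem IsProfile.solvesPhotonODE_of_orbit (h : S.IsProfile ρ T) (hn : 2 ≤ n)
    (hζ : IsNullGeodesic (S.metric n) (S.carrier n) ζ J) (horb : rotSurface n ρ T = orbit ζ J) :
    S.SolvesPhotonODE ρ T ∧ (fun s => (ζ s).1) '' J = T ∧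
      (∀ s ∈ J, ζ s ∈ rotSurface n ρ T) ∧ ∀ s ∈ J, 0 < angularMomentum ζ s := by
  have hg := hζ.isGeodesic
  have hmem : ∀ s ∈ J, ζ s ∈ rotSurface n ρ T := by
    intro s hs
    have : ‖(ζ s).2‖ ≠ 0 := by simpa using S.snd_ne_zero (hg.mapsTo hs)
    rw [horb]
    exact ⟨s, hs, angle (ζ s), by simp [angle, norm_smul, this], rfl, by
      simp [angle, radius, smul_smul, this]⟩
  have htan : ∀ s ∈ J, deriv ζ s ∈ tangentSet (rotSurface n ρ T) (ζ s) := fun s hs =>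
    deriv_mem_tangentSet (hg.hasDerivAt hs).differentiableAt
      (by filter_upwards [hg.isOpen.mem_nhds hs] with u hu using hmem u hu)
  have hℓ : ∀ s ∈ J, 0 < angularMomentum ζ s := fun s hs =>
    (h.deriv_sq_of_tangent hζ hs (hmem s hs) (htan s hs)).1
  have himg : (fun s => (ζ s).1) '' J = T := by
    refine Set.Subset.antisymm ?_ fun t ht => ?_
    · rintro _ ⟨s, hs, rfl⟩
      exact (hmem s hs).1
    · rw [← h.fst_image hn, horb] at ht
      obtain ⟨p, ⟨s, hs, -, -, hp, -⟩, rfl⟩ := ht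
      exact ⟨s, hs, hp.symm⟩
  obtain ⟨s₁, hs₁⟩ := hg.nonempty
  obtain ⟨σ, hσ, hode, -, hσr, -, -⟩ := hζ.exists_profile
    (fun s hs => hg.energy_eq_energy hs hs₁) (fun s hs => hg.angularMomentum_eq_angularMomentum hs hs₁)
    (hℓ s₁ hs₁)
  rw [himg] at hσ hode
  -- Both functions give the radius of the geodesic at time t, and its times exhaust T.
  have heq : ∀ t ∈ T, ρ t = σ t := by
    intro t ht
    rw [← himg] at ht
    obtain ⟨s, hs, rfl⟩ := ht
    exact (hmem s hs).2.symm.trans (hσr s hs).symm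
  refine ⟨fun t ht => ?_, himg, hmem, hℓ⟩
  have e : ρ =ᶠ[𝓝 t] σ := by
    filter_upwards [h.isOpen.mem_nhds ht] with u hu using heq u hu
  rw [e.deriv.deriv_eq, e.deriv_eq, e.eq_of_nhds, hode t ht]

/-- Tangency forces ℓ > 0, so the radius of the geodesic as a function of time solves the same
equation; membership and tangency match value and slope, and uniqueness keeps the geodesic in the
surface. -/
theorem SolvesPhotonODE.isNullTotallyGeodesic (hode : S.SolvesPhotonODE ρ T)
    (h : S.IsProfile ρ T) :
    IsNullTotallyGeodesic (S.metric n) (S.carrier n) (rotSurface n ρ T) := by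
  intro ζ J hζ s₀ hs₀ hmem htan
  have hg := hζ.isGeodesic
  obtain ⟨hℓ, hdr, -⟩ := h.deriv_sq_of_tangent hζ hs₀ hmem htan
  obtain ⟨σ, hσ, hode', -, hσr, hσd, -⟩ := hζ.exists_profile
    (fun s hs => hg.energy_eq_energy hs hs₀)
    (fun s hs => hg.angularMomentum_eq_angularMomentum hs hs₀) hℓ
  have hrad : radius (ζ s₀) = ρ (ζ s₀).1 := hmem.2
  have hderiv : deriv ρ (ζ s₀).1 = deriv σ (ζ s₀).1 := by
    have hf := (hg.f_pos hs₀).ne'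
    have hE := hζ.energy_ne_zero hs₀
    rw [hσd s₀ hs₀, hdr]
    rw [S.energy_eq (hg.mapsTo hs₀)] at hE ⊢
    have hv := right_ne_zero_of_mul hE
    field_simp
  have heq := hode.eventuallyEq h hode' hσ hmem.1 ⟨s₀, hs₀, rfl⟩
    (by rw [hσr s₀ hs₀, hrad]) hderiv
  have hcont : ContinuousAt (fun s => (ζ s).1) s₀ := (hg.hasDerivAt hs₀).fst_comp.continuousAt
  have hev : ∀ᶠ s in 𝓝 s₀, s ∈ J ∧ ζ s ∈ rotSurface n ρ T := by
    filter_upwards [hcont.eventually heq, hcont.eventually (h.isOpen.mem_nhds hmem.1),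
      hg.isOpen.mem_nhds hs₀] with s h1 h2 h3
    exact ⟨h3, h2, by rw [h1, hσr s h3]; rfl⟩
  -- Tangency at a nearby s needs the curve to lie in the surface on a whole neighbourhood of s.
  filter_upwards [hev.eventually_nhds] with s hs
  exact ⟨hs.self_of_nhds.2, deriv_mem_tangentSet
    (hg.hasDerivAt hs.self_of_nhds.1).differentiableAt (hs.mono fun u hu => hu.2)⟩

theorem SolvesPhotonODE.isSymmetricPhotonSurface (hode : S.SolvesPhotonODE ρ T)
    (h : S.IsProfile ρ T) (hn : 2 ≤ n) : S.IsSymmetricPhotonSurface (rotSurface n ρ T) :=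
  ⟨⟨h.isHypersurface, h.isTimelike, hode.isNullTotallyGeodesic h⟩, h.isConnected hn,
    h.isSphericallySymmetric⟩

theorem SolvesPhotonODE.exists_generates (hode : S.SolvesPhotonODE ρ T)
    (h : S.IsProfile ρ T) (hn : 2 ≤ n) :
    ∃ (ζ : ℝ → Pt n) (J : Set ℝ), S.Generates ζ J (rotSurface n ρ T) := by
  obtain ⟨e₁, e₂, he₁, he₂, he⟩ := exists_orthonormal_pair hn
  obtain ⟨κ, hκ, hint⟩ := hode.exists_first_integral h
  obtain ⟨t₀, ht₀⟩ := h.nonempty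
  -- Only the ratio ℓ/E matters, since rescaling the affine parameter scales both; E = 1 and ℓ = κ
  -- is a choice.
  obtain ⟨A, ψ, ζ, -, -, -, -, hζ, hζA⟩ := hode.exists_geodesic h (E := 1) (ℓ := κ) one_ne_zero
    (by simpa using hint) he₁ he₂ he ht₀ 0
  refine ⟨ζ, A '' T, hζ, (h.orbit_eq ?_ ?_).symm⟩
  · rw [Set.image_image]
    calc (fun t => (ζ (A t)).1) '' T = id '' T := Set.image_congr fun t ht => by rw [hζA t ht]; rfl
      _ = T := Set.image_id T
  · rintro _ ⟨t, ht, rfl⟩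
    rw [hζA t ht, radius, norm_smul, norm_cos_smul_add_sin_smul he₁ he₂ he, mul_one,
      Real.norm_of_nonneg (h.pos ht).le]

/-- At each t₀ the surface is compared with the local solution σ having the same value and slope. A
null geodesic generating the rotation of σ is tangent to the surface at t₀, hence stays in it, so ρ
= σ near t₀. -/
theorem IsProfile.solvesPhotonODE_of_isNullTotallyGeodesic (h : S.IsProfile ρ T) (hn : 2 ≤ n)
    (hH : IsNullTotallyGeodesic (S.metric n) (S.carrier n) (rotSurface n ρ T)) :
    S.SolvesPhotonODE ρ T := by
  intro t₀ ht₀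
  obtain ⟨e₁, e₂, he₁, he₂, he⟩ := exists_orthonormal_pair hn
  obtain ⟨σ, T', hσ, hode, ht₀', hσ0, hσ1⟩ :=
    S.exists_solvesPhotonODE (h.mapsTo ht₀) (h.slope t₀ ht₀) t₀
  obtain ⟨κ, hκ, hint⟩ := hode.exists_first_integral hσ
  obtain ⟨A, ψ, ζ, hA0, hψ0, hAd, -, hζ, hζA⟩ := hode.exists_geodesic hσ (E := 1) (ℓ := κ)
    one_ne_zero (by simpa using hint) he₁ he₂ he ht₀' 0
  have hg := hζ.isGeodesic
  have hs₀ : A t₀ ∈ A '' T' := ⟨t₀, ht₀', rfl⟩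
  have hmemσ : ∀ s ∈ A '' T', ζ s ∈ rotSurface n σ T' := by
    rintro _ ⟨t, ht, rfl⟩
    rw [hζA t ht]
    exact hσ.mem_rotSurface_smul ht (norm_cos_smul_add_sin_smul he₁ he₂ he _)
  have ht1 : (ζ (A t₀)).1 = t₀ := by rw [hζA t₀ ht₀']
  have hmem : ζ (A t₀) ∈ rotSurface n ρ T := by
    refine ⟨by rwa [ht1], ?_⟩
    rw [(hmemσ _ hs₀).2, ht1, hσ0]
  have htan : deriv ζ (A t₀) ∈ tangentSet (rotSurface n ρ T) (ζ (A t₀)) := by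
    have h1 := deriv_mem_tangentSet (hg.hasDerivAt hs₀).differentiableAt
      (by filter_upwards [hg.isOpen.mem_nhds hs₀] with u hu using hmemσ u hu)
    -- The tangent space at a point depends only on the value and slope of the profile there.
    rw [hσ.mem_tangentSet_iff (hmemσ _ hs₀), ht1, hσ0, hσ1] at h1
    rw [h.mem_tangentSet_iff hmem, ht1, h1]
  have hev := (hAd t₀ ht₀').continuousAt.eventually (hH ζ _ hζ _ hs₀ hmem htan)
  have e : ρ =ᶠ[𝓝 t₀] σ := by
    filter_upwards [hev, hσ.isOpen.mem_nhds ht₀'] with t h1 h2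
    have h3 := h1.1.2
    rw [hζA t h2, norm_smul, norm_cos_smul_add_sin_smul he₁ he₂ he, mul_one,
      Real.norm_of_nonneg (hσ.pos h2).le] at h3
    exact h3.symm
  rw [e.deriv.deriv_eq, e.deriv_eq, e.eq_of_nhds, hode t₀ ht₀']

/-- A symmetric photon surface with first integral `1 / lam` has umbilicity factor `lam`. -/
theorem SolvesPhotonODE.hasUmbilicityFactor (hode : S.SolvesPhotonODE ρ T)
    (h : S.IsProfile ρ T) {lam : ℝ} (hlam : 0 < lam)
    (hint : ∀ t ∈ T, deriv ρ t ^ 2 = S.f (ρ t) ^ 2 * (1 - 1 / lam ^ 2 * S.f (ρ t) / ρ t ^ 2)) :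
    S.HasUmbilicityFactor (rotSurface n ρ T) lam := by
  intro p hp
  -- Up to the factor, this is r(ρ'/f² ∂_t + ∂_r), extended off the surface. Its square on the
  -- surface is r²(f² - ρ'²)/f³, the first integral 1/lam², so a constant factor normalises it.
  let η : Pt n → Pt n := fun q =>
    lam • (radius q * deriv ρ q.1 / S.f (radius q) ^ 2, q.2)
  refine ⟨Prod.fst ⁻¹' T ∩ S.carrier n, η,
    (h.isOpen.preimage continuous_fst).inter S.isOpen_carrier, ⟨hp.1, h.mem_carrier hp⟩,
    ⟨?_, ?_, ?_, ?_⟩, ?_⟩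
  · have h1 : ContDiffOn ℝ ∞ (radius (n := n)) (Prod.fst ⁻¹' T ∩ S.carrier n) :=
      (contDiffOn_snd).norm ℝ fun q hq => S.snd_ne_zero hq.2
    have h2 : ContDiffOn ℝ ∞ (fun q : Pt n => S.f (radius q)) (Prod.fst ⁻¹' T ∩ S.carrier n) :=
      S.smooth.comp h1 fun q hq => hq.2
    have h3 : ContDiffOn ℝ ∞ (fun q : Pt n => deriv ρ q.1) (Prod.fst ⁻¹' T ∩ S.carrier n) :=
      h.smooth_deriv.comp contDiffOn_fst fun q hq => hq.1
    exact ContDiffOn.const_smul lam (((h1.mul h3).div (h2.pow 2) fun q hq =>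
      pow_ne_zero 2 (S.f_pos _ hq.2).ne').prodMk contDiffOn_snd)
  · rintro q ⟨hq, -⟩ v hv
    have hr := (h.pos hq.1).ne'
    have hf := (h.f_pos hq.1).ne'
    have hrad : radius q = ρ q.1 := hq.2
    have hself : ⟪q.2, q.2⟫_ℝ = ρ q.1 ^ 2 := by rw [real_inner_self_eq_norm_sq, hq.2]
    rw [h.mem_tangentSet_iff hq] at hv
    rw [S.metric_eq (S.snd_ne_zero (h.mem_carrier hq))]
    simp only [η, Prod.smul_fst, Prod.smul_snd, smul_eq_mul, real_inner_smul_left,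
      real_inner_smul_right, hself, hv, hrad, warp]
    field_simp
    ring
  · rintro q ⟨hq, -⟩
    have hr := (h.pos hq.1).ne'
    have hf := (h.f_pos hq.1).ne'
    have hrad : radius q = ρ q.1 := hq.2
    have hself : ⟪q.2, q.2⟫_ℝ = ρ q.1 ^ 2 := by rw [real_inner_self_eq_norm_sq, hq.2]
    rw [S.metric_eq (S.snd_ne_zero (h.mem_carrier hq))]
    simp only [η, Prod.smul_fst, Prod.smul_snd, smul_eq_mul, real_inner_smul_left,
      real_inner_smul_right, hself, hrad, warp]
    have := hint _ hq.1
    field_simp at this ⊢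
    linear_combination -this
  · rintro q ⟨hq, -⟩
    have hself : ⟪q.2, q.2⟫_ℝ = radius q ^ 2 := real_inner_self_eq_norm_sq _
    have : 0 < radius q := S.pos (h.mem_carrier hq)
    rw [dr_apply]
    simp only [η, Prod.smul_snd, real_inner_smul_right, hself]
    positivity
  · intro u hu v hv
    have hpc := h.mem_carrier hp
    have hp2 := S.snd_ne_zero hpc
    have hr := (h.pos hp.1).ne'
    have hf := (h.f_pos hp.1).ne'
    have hrad : radius p = ρ p.1 := hp.2
    have hself : ⟪p.2, p.2⟫_ℝ = ρ p.1 ^ 2 := by rw [real_inner_self_eq_norm_sq, hp.2]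
    have hrd := hasFDerivAt_radius p hp2
    have hfd := (S.differentiableAt_f hpc).hasDerivAt.comp_hasFDerivAt p hrd
    have hρd := (h.hasDerivAt_deriv hp.1).comp_hasFDerivAt p (hasFDerivAt_fst (𝕜 := ℝ) (p := p))
    have hinv := (((hasDerivAt_pow 2 (S.f (radius p))).inv
      (pow_ne_zero 2 (S.f_pos _ hpc).ne')).comp_hasFDerivAt p hfd)
    have hηd : HasFDerivAt η _ p :=
      (((hrd.mul hρd).mul hinv).prodMk (hasFDerivAt_snd (𝕜 := ℝ) (p := p))).const_smul lam
    have hηu : fderiv ℝ η p u = lam •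
        ((dr p u * deriv ρ p.1 + radius p * (deriv (deriv ρ) p.1 * u.1)) / S.f (radius p) ^ 2
          - 2 * radius p * deriv ρ p.1 * deriv S.f (radius p) * dr p u / S.f (radius p) ^ 3, u.2) := by
      rw [hηd.fderiv]
      have hf' := (S.f_pos _ hpc).ne'
      ext1
      · simp [-mul_eq_mul_left_iff]
        field_simp
        ring
      · simp
    rw [h.mem_tangentSet_iff hp] at hu hv
    -- For the field without the factor lam, the equation for ρ'' gives g(∇_u η, v) = g(u, v) on
    -- tangent vectors; the umbilicity factor is therefore the normalising constant.
    rw [covDerivPairing, hηu, S.christoffel_metric hpc, S.metric_eq hp2, S.metric_eq hp2, dr_apply,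
      hode _ hp.1, accel]
    simp only [η, Prod.smul_fst, Prod.smul_snd, smul_eq_mul, real_inner_smul_left,
      real_inner_smul_right, hself, hu, hv, hrad, warp, warpDeriv, real_inner_comm p.2 u.2]
    field_simp
    ring

end ClassS

end PhotonSurfaces

/-! ### Maximality of surfaces and of their generating geodesics. -/

namespace PhotonSurfaces

variable {n : ℕ} {S : ClassS} {ρ σ : ℝ → ℝ} {T T' J : Set ℝ} {ζ : ℝ → Pt n}

/-- The angular part of a non-radial null geodesic runs through a great circle. -/
theorem IsNullGeodesic.angle_eq (hζ : IsNullGeodesic (S.metric n) (S.carrier n) ζ J) {ℓ : ℝ}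
    (hℓ : ∀ s ∈ J, ClassS.angularMomentum ζ s = ℓ) (hpos : 0 < ℓ) {s₀ : ℝ} (hs₀ : s₀ ∈ J) :
    ∃ e₁ e₂ : EuclideanSpace ℝ (Fin n), ‖e₁‖ = 1 ∧ ‖e₂‖ = 1 ∧ ⟪e₁, e₂⟫_ℝ = 0 ∧
      ∀ φ : ℝ → ℝ, φ s₀ = 0 → (∀ s ∈ J, HasDerivAt φ (ℓ / radius (ζ s) ^ 2) s) →
        ∀ s ∈ J, (ζ s).2 = radius (ζ s) • (Real.cos (φ s) • e₁ + Real.sin (φ s) • e₂) := by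
  have hg := hζ.isGeodesic
  -- ν is the unit direction of ξ', written so that its derivative is easy to take; the pair
  -- satisfies ξ' = (ℓ/r²)ν and ν' = -(ℓ/r²)ξ.
  let ν : ℝ → EuclideanSpace ℝ (Fin n) := fun s =>
    ℓ⁻¹ • (radius (ζ s) • (deriv ζ s).2 - dr (ζ s) (deriv ζ s) • (ζ s).2)
  have hx : ∀ s ∈ J, (ζ s).2 = radius (ζ s) • angle (ζ s) := fun s hs => by
    have : ‖(ζ s).2‖ ≠ 0 := (hg.radius_pos hs).ne'
    simp [angle, radius, smul_smul, this]
  have hνd : ∀ s ∈ J, ν s = (radius (ζ s) ^ 2 / ℓ) • dξ (ζ s) (deriv ζ s) := by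
    intro s hs
    have hr := (hg.radius_pos hs).ne'
    simp only [ν, dξ, smul_apply, sub_apply, ContinuousLinearMap.smulRight_apply,
      ContinuousLinearMap.coe_snd']
    nth_rewrite 1 [hx s hs]
    match_scalars <;> field_simp
  have hξd : ∀ s ∈ J, HasDerivAt (fun s => angle (ζ s)) ((ℓ / radius (ζ s) ^ 2) • ν s) s := by
    intro s hs
    have hr := (hg.radius_pos hs).ne'
    refine ((hasFDerivAt_angle _ (S.snd_ne_zero (hg.mapsTo hs))).comp_hasDerivAt s
      (hg.hasDerivAt hs)).congr_deriv ?_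
    rw [hνd s hs, smul_smul]
    have : ℓ / radius (ζ s) ^ 2 * (radius (ζ s) ^ 2 / ℓ) = 1 := by field_simp
    rw [this, one_smul]
  have hνd' : ∀ s ∈ J, HasDerivAt ν (-(ℓ / radius (ζ s) ^ 2) • angle (ζ s)) s := by
    intro s hs
    have hr := (hg.radius_pos hs).ne'
    refine ((((hg.hasDerivAt_radius hs).smul (hg.hasDerivAt_deriv hs).snd_comp).sub
      ((hζ.hasDerivAt_radial_velocity hs).smul (hg.hasDerivAt hs).snd_comp)).const_smul
        ℓ⁻¹).congr_deriv ?_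
    rw [hℓ s hs]
    obtain ⟨A, hA⟩ : ∃ A, A = ⟪(ζ s).2, (deriv (deriv ζ) s).2⟫_ℝ := ⟨_, rfl⟩
    have h1 := hg.snd_deriv_deriv hs
    rw [← hA] at h1 ⊢
    rw [h1, hx s hs]
    match_scalars
    · field_simp
      ring
    · ring
  refine ⟨angle (ζ s₀), ν s₀, ?_, ?_, ?_, ?_⟩
  · have : ‖(ζ s₀).2‖ ≠ 0 := (hg.radius_pos hs₀).ne'
    simp [angle, norm_smul, this]
  · have h1 := hℓ s₀ hs₀
    rw [ClassS.angularMomentum] at h1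
    rw [hνd s₀ hs₀, norm_smul, Real.norm_of_nonneg (by positivity), div_mul_eq_mul_div, h1,
      div_self hpos.ne']
  · have hr : ‖(ζ s₀).2‖ ≠ 0 := (hg.radius_pos hs₀).ne'
    simp only [ν, angle, dr_apply, radius, inner_sub_right, real_inner_smul_left,
      real_inner_smul_right, real_inner_self_eq_norm_sq]
    field_simp
    ring
  · intro φ hφ0 hφ s hs
    -- Rotating the frame (ξ, ν) back by φ makes it constant; inverting that rotation recovers ξ.
    have hP : ∀ u ∈ J, HasDerivAt
        (fun u => Real.cos (φ u) • angle (ζ u) - Real.sin (φ u) • ν u) 0 u := by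
      intro u hu
      refine (((hφ u hu).cos.smul (hξd u hu)).sub
        ((hφ u hu).sin.smul (hνd' u hu))).congr_deriv ?_
      module
    have hQ : ∀ u ∈ J, HasDerivAt
        (fun u => Real.sin (φ u) • angle (ζ u) + Real.cos (φ u) • ν u) 0 u := by
      intro u hu
      refine (((hφ u hu).sin.smul (hξd u hu)).add
        ((hφ u hu).cos.smul (hνd' u hu))).congr_deriv ?_
      module
    have hP' := eq_of_hasDerivAt_zero_on_interval hg.ordConnected hP hs₀ hs
    have hQ' := eq_of_hasDerivAt_zero_on_interval hg.ordConnected hQ hs₀ hs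
    simp only [hφ0, Real.cos_zero, Real.sin_zero, one_smul, zero_smul, sub_zero, zero_add] at hP' hQ'
    rw [hP', hQ']
    nth_rewrite 1 [hx s hs]
    congr 1
    have := Real.cos_sq_add_sin_sq (φ s)
    clear_value ν
    match_scalars
    · linear_combination -this
    · ring

/-- A null geodesic in a symmetric photon surface extends to a null geodesic through all of the
surface. -/
theorem ClassS.SolvesPhotonODE.exists_extension (hode : S.SolvesPhotonODE ρ T)
    (h : S.IsProfile ρ T) (hζ : IsNullGeodesic (S.metric n) (S.carrier n) ζ J)
    (hmem : ∀ s ∈ J, ζ s ∈ rotSurface n ρ T) :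
    ∃ (ζ' : ℝ → Pt n) (J' : Set ℝ), IsNullGeodesic (S.metric n) (S.carrier n) ζ' J' ∧ J ⊆ J' ∧
      Set.EqOn ζ ζ' J ∧ (fun s => (ζ' s).1) '' J' = T := by
  have hg := hζ.isGeodesic
  obtain ⟨s₀, hs₀⟩ := hg.nonempty
  obtain ⟨E, hE⟩ : ∃ E, E = S.energy ζ s₀ := ⟨_, rfl⟩
  obtain ⟨ℓ, hℓ⟩ : ∃ ℓ, ℓ = angularMomentum ζ s₀ := ⟨_, rfl⟩
  have hE0 : E ≠ 0 := hE ▸ hζ.energy_ne_zero hs₀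
  have htan := deriv_mem_tangentSet (hg.hasDerivAt hs₀).differentiableAt
    (by filter_upwards [hg.isOpen.mem_nhds hs₀] with u hu using hmem u hu)
  obtain ⟨hpos, -, hsq⟩ := h.deriv_sq_of_tangent hζ hs₀ (hmem s₀ hs₀) htan
  rw [← hE, ← hℓ] at hsq
  rw [← hℓ] at hpos
  obtain ⟨κ, hκ, hint⟩ := hode.exists_first_integral h
  -- The first integral of the surface and the constants of the geodesic are compared at a single
  -- point.
  have hκ' : κ ^ 2 = ℓ ^ 2 / E ^ 2 := by
    have hr := h.pos (hmem s₀ hs₀).1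
    have hf := h.f_pos (hmem s₀ hs₀).1
    have h1 := (hint _ (hmem s₀ hs₀).1).symm.trans hsq
    field_simp at h1 ⊢
    refine mul_left_cancel₀ hf.ne' ?_
    linear_combination -h1
  rw [hκ'] at hint
  obtain ⟨e₁, e₂, he₁, he₂, he, hangle⟩ := hζ.angle_eq
    (fun s hs => (hg.angularMomentum_eq_angularMomentum hs hs₀).trans hℓ.symm) hpos hs₀
  obtain ⟨A, ψ, ζ', hA0, hψ0, hAd, hψd, hζ', hζA⟩ := hode.exists_geodesic h hE0 hint he₁ he₂ he
    (hmem s₀ hs₀).1 s₀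
  have htd : ∀ s ∈ J, HasDerivAt (fun s => (ζ s).1) (E / S.f (ρ (ζ s).1)) s := by
    intro s hs
    refine (hg.hasDerivAt hs).fst_comp.congr_deriv ?_
    have hf := (hg.f_pos hs).ne'
    have hrad : radius (ζ s) = ρ (ζ s).1 := (hmem s hs).2
    rw [hE, hg.energy_eq_energy hs₀ hs, S.energy_eq (hg.mapsTo hs), ← hrad]
    field_simp
  -- By the chain rule A(t(s)) has derivative (f/E)(E/f) = 1, so the reconstructed geodesic has the
  -- original parametrisation. The angles then agree by `angle_eq`, and the two curves coincide by
  -- explicit formulas.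
  have hA : ∀ s ∈ J, A (ζ s).1 = s := by
    intro s hs
    have hd : ∀ u ∈ J, HasDerivAt (fun u => A (ζ u).1 - u) 0 u := by
      intro u hu
      refine (((hAd _ (hmem u hu).1).comp u (htd u hu)).sub (hasDerivAt_id u)).congr_deriv ?_
      have hf := (h.f_pos (hmem u hu).1).ne'
      field_simp
      ring
    have := eq_of_hasDerivAt_zero_on_interval hg.ordConnected hd hs hs₀
    simp only [hA0, sub_self] at this
    linarith
  refine ⟨ζ', A '' T, hζ', fun s hs => ⟨(ζ s).1, (hmem s hs).1, hA s hs⟩, fun s hs => ?_, ?_⟩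
  · have h1 := hζA _ (hmem s hs).1
    rw [hA s hs] at h1
    have hrad : radius (ζ s) = ρ (ζ s).1 := (hmem s hs).2
    rw [h1]
    refine Prod.ext rfl ?_
    rw [hangle (fun s => ψ (ζ s).1) hψ0 (fun u hu => ?_) s hs, hrad]
    refine ((hψd _ (hmem u hu).1).comp u (htd u hu)).congr_deriv ?_
    have hradu : radius (ζ u) = ρ (ζ u).1 := (hmem u hu).2
    have hf := (h.f_pos (hmem u hu).1).ne'
    rw [hradu]
    field_simp
  · rw [Set.image_image]
    calc (fun t => (ζ' (A t)).1) '' T = id '' T := Set.image_congr fun t ht => by rw [hζA t ht]; rfl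
      _ = T := Set.image_id T

/-- In a larger symmetric photon surface the generating geodesic would extend over all of its times;
maximality of the geodesic leaves the same times, hence the same spheres. -/
theorem ClassS.IsProfile.isMaximalPhotonSurface (h : S.IsProfile ρ T) (hn : 2 ≤ n)
    (hgen : S.Generates ζ J (rotSurface n ρ T))
    (hmax : IsMaximalGeodesic (S.metric n) (S.carrier n) ζ J) :
    S.IsMaximalPhotonSurface (rotSurface n ρ T) := by
  obtain ⟨hode, himg, hmem, -⟩ := h.solvesPhotonODE_of_orbit hn hgen.1 hgen.2
  refine ⟨hode.isSymmetricPhotonSurface h hn, fun Q hQ hPQ => ?_⟩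
  obtain ⟨σ, T', hσ, rfl⟩ := exists_profile hQ.isPhotonSurface.hypersurface hQ.isConnected
    hQ.sphericallySymmetric hQ.isPhotonSurface.timelike
  have hode' := hσ.solvesPhotonODE_of_isNullTotallyGeodesic hn
    hQ.isPhotonSurface.nullTotallyGeodesic
  obtain ⟨ζ', J', hζ', hJJ', heq, himg'⟩ :=
    hode'.exists_extension hσ hgen.1 fun s hs => hPQ (hmem s hs)
  have hJ := hmax.2 ζ' J' hζ'.isGeodesic hJJ' heq
  have hT : T' = T := by
    rw [← himg', ← himg, hJ]
    exact Set.image_congr fun s hs => by rw [heq hs]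
  refine Set.Subset.antisymm (fun q hq => ?_) hPQ
  have ht : q.1 ∈ T := hT ▸ hq.1
  obtain ⟨e₁, -, he₁, -⟩ := exists_orthonormal_pair hn
  have h1 := (hPQ (h.mem_rotSurface_smul ht he₁)).2
  rw [(h.mem_rotSurface_smul ht he₁).2] at h1
  exact ⟨ht, hq.2.trans h1.symm⟩

/-- An extension of a generating geodesic is again null with ℓ > 0, so its orbit is a symmetric
photon surface containing the given one, and hence equal to it. -/
theorem ClassS.IsMaximalPhotonSurface.isMaximalGeodesic {H : Set (Pt n)} (hn : 2 ≤ n)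
    (hmax : S.IsMaximalPhotonSurface H) (hgen : S.Generates ζ J H) :
    IsMaximalGeodesic (S.metric n) (S.carrier n) ζ J := by
  have hP := hmax.1
  obtain ⟨ρ, T, h, rfl⟩ := exists_profile hP.isPhotonSurface.hypersurface hP.isConnected
    hP.sphericallySymmetric hP.isPhotonSurface.timelike
  have hζ := hgen.1
  have hg := hζ.isGeodesic
  obtain ⟨-, -, hmem, hℓ⟩ := h.solvesPhotonODE_of_orbit hn hζ hgen.2
  refine ⟨hg, fun ζ' J' hg' hJJ' heq => ?_⟩
  obtain ⟨s₀, hs₀⟩ := hg.nonempty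
  have hderiv : deriv ζ' s₀ = deriv ζ s₀ := by
    refine Filter.EventuallyEq.deriv_eq ?_
    filter_upwards [hg.isOpen.mem_nhds hs₀] with u hu using (heq hu).symm
  have hpt : ζ' s₀ = ζ s₀ := (heq hs₀).symm
  have hE : S.energy ζ' s₀ = S.energy ζ s₀ := by
    rw [ClassS.energy, ClassS.energy, hderiv, hpt]
  have hL : angularMomentum ζ' s₀ = angularMomentum ζ s₀ := by
    rw [angularMomentum, angularMomentum, hderiv, hpt]
  -- The extension is only assumed to be a geodesic: nullity propagates because g(ζ', ζ') is
  -- constant, and the velocity cannot vanish because the non-zero energy is conserved.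
  have hζ' : IsNullGeodesic (S.metric n) (S.carrier n) ζ' J' := by
    refine ⟨hg', fun s hs => ?_, fun s hs h0 => ?_⟩
    · rw [hg'.metric_deriv_eq (fun p hp => S.differentiableAt_metric hp)
        (fun p hp => S.metric_symm hp) hs (hJJ' hs₀), hderiv, hpt]
      exact hζ.null s₀ hs₀
    · refine hζ.energy_ne_zero hs₀ ?_
      rw [← hE, hg'.energy_eq_energy (hJJ' hs₀) hs, S.energy_eq (hg'.mapsTo hs), h0]
      simp
  obtain ⟨σ, hσ, hode, hinj, hσr, -, -⟩ := hζ'.exists_profile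
    (fun s hs => hg'.energy_eq_energy hs (hJJ' hs₀))
    (fun s hs => hg'.angularMomentum_eq_angularMomentum hs (hJJ' hs₀)) (hL ▸ hℓ s₀ hs₀)
  have horb := hσ.orbit_eq rfl hσr
  have hsub : rotSurface n ρ T ⊆ rotSurface n σ ((fun s => (ζ' s).1) '' J') := by
    rw [hgen.2, ← horb]
    rintro p ⟨s, hs, hp⟩
    refine ⟨s, hJJ' hs, ?_⟩
    rwa [← heq hs]
  have hQ := hmax.2 _ (hode.isSymmetricPhotonSurface hσ hn) hsub
  refine Set.Subset.antisymm (fun s hs => ?_) hJJ'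
  have h1 : ζ' s ∈ orbit ζ J := by
    rw [← hgen.2, ← hQ]
    exact ⟨⟨s, hs, rfl⟩, (hσr s hs).symm⟩
  obtain ⟨s₁, hs₁, -, -, ht, -⟩ := h1
  rw [heq hs₁] at ht
  -- Every time of the extension is already attained on J, and time is injective along it, so no
  -- parameter is new.
  rwa [hinj hs (hJJ' hs₁) ht]

end PhotonSurfaces

/-! ### Assembly for a profile, and the proposition. -/

namespace PhotonSurfaces

theorem ClassS.IsProfile.isPhotonSurface_iff {n : ℕ} {S : ClassS} {ρ : ℝ → ℝ} {T : Set ℝ}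
    (h : S.IsProfile ρ T) (hn : 2 ≤ n) :
    (∃ (ζ : ℝ → Pt n) (J : Set ℝ), S.Generates ζ J (rotSurface n ρ T)) ↔
      IsPhotonSurface (S.metric n) (S.carrier n) (rotSurface n ρ T) := by
  constructor
  · rintro ⟨ζ, J, hζ, horb⟩
    have hode := (h.solvesPhotonODE_of_orbit hn hζ horb).1
    exact (hode.isSymmetricPhotonSurface h hn).isPhotonSurface
  · intro hP
    exact (h.solvesPhotonODE_of_isNullTotallyGeodesic hn
      hP.nullTotallyGeodesic).exists_generates h hn

theorem ClassS.IsProfile.exists_umbilicityFactor {n : ℕ} {S : ClassS} {ρ : ℝ → ℝ} {T : Set ℝ}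
    (h : S.IsProfile ρ T) (hn : 2 ≤ n) {ζ : ℝ → Pt n} {J : Set ℝ}
    (hgen : S.Generates ζ J (rotSurface n ρ T)) :
    ∃ E ℓ : ℝ, (∀ s ∈ J, S.energy ζ s = E) ∧ (∀ s ∈ J, angularMomentum ζ s = ℓ) ∧ 0 < ℓ ∧
      S.HasUmbilicityFactor (rotSurface n ρ T) (|E| / ℓ) ∧
      (IsFutureDirected ζ J → S.HasUmbilicityFactor (rotSurface n ρ T) (E / ℓ)) := by
  obtain ⟨hζ, horb⟩ := hgen
  have hg := hζ.isGeodesic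
  obtain ⟨hode, himg, hmem, hℓ⟩ := h.solvesPhotonODE_of_orbit hn hζ horb
  obtain ⟨s₀, hs₀⟩ := hg.nonempty
  have hE : ∀ s ∈ J, S.energy ζ s = S.energy ζ s₀ := fun s hs => hg.energy_eq_energy hs hs₀
  have hL : ∀ s ∈ J, angularMomentum ζ s = angularMomentum ζ s₀ := fun s hs =>
    hg.angularMomentum_eq_angularMomentum hs hs₀
  have hE0 := hζ.energy_ne_zero hs₀
  have hL0 := hℓ s₀ hs₀
  have humb : S.HasUmbilicityFactor (rotSurface n ρ T)
      (|S.energy ζ s₀| / angularMomentum ζ s₀) := by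
    refine hode.hasUmbilicityFactor h (div_pos (abs_pos.2 hE0) hL0) fun t ht => ?_
    rw [← himg] at ht
    obtain ⟨s, hs, rfl⟩ := ht
    have htan := deriv_mem_tangentSet (hg.hasDerivAt hs).differentiableAt
      (by filter_upwards [hg.isOpen.mem_nhds hs] with u hu using hmem u hu)
    have := (h.deriv_sq_of_tangent hζ hs (hmem s hs) htan).2.2
    rw [hE s hs, hL s hs] at this
    -- The tangency relation has first integral ℓ²/E² = 1/lam² with lam = |E|/ℓ; the absolute value
    -- keeps lam positive for past-directed geodesics.
    rw [this, div_pow, sq_abs, one_div_div]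
  refine ⟨_, _, hE, hL, hL0, humb, fun hfut => ?_⟩
  have hpos : 0 < S.energy ζ s₀ := by
    rw [S.energy_eq (hg.mapsTo hs₀)]
    exact mul_pos (hg.f_pos hs₀) (hfut s₀ hs₀)
  rwa [abs_of_pos hpos] at humb

end PhotonSurfaces

end

theorem proposition3p5 (n : ℕ) (hn : 2 ≤ n) (S : PhotonSurfaces.ClassS)
    (H : Set (PhotonSurfaces.Pt n))
    (hH : PhotonSurfaces.IsHypersurface (S.carrier n) H)
    (hconn : IsConnected H)
    (hsym : S.IsSphericallySymmetric H)
    (htime : PhotonSurfaces.IsTimelike (S.metric n) H) :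
    -- generated by a null geodesic iff photon surface
    ((∃ (ζ : ℝ → PhotonSurfaces.Pt n) (J : Set ℝ), S.Generates ζ J H) ↔
      PhotonSurfaces.IsPhotonSurface (S.metric n) (S.carrier n) H) ∧
    -- maximal iff generated by a null geodesic and every generating null geodesic is maximal
    (S.IsMaximalPhotonSurface H ↔
      (∃ (ζ : ℝ → PhotonSurfaces.Pt n) (J : Set ℝ), S.Generates ζ J H) ∧
      ∀ (ζ : ℝ → PhotonSurfaces.Pt n) (J : Set ℝ), S.Generates ζ J H →
        PhotonSurfaces.IsMaximalGeodesic (S.metric n) (S.carrier n) ζ J) ∧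
    -- maximal iff some generating null geodesic is maximal
    (S.IsMaximalPhotonSurface H ↔
      ∃ (ζ : ℝ → PhotonSurfaces.Pt n) (J : Set ℝ), S.Generates ζ J H ∧
        PhotonSurfaces.IsMaximalGeodesic (S.metric n) (S.carrier n) ζ J) ∧
    -- energy and angular momentum of generating null geodesics, and the umbilicity factor
    (∀ (ζ : ℝ → PhotonSurfaces.Pt n) (J : Set ℝ), S.Generates ζ J H →
      ∃ E ℓ : ℝ, (∀ s ∈ J, S.energy ζ s = E) ∧
        (∀ s ∈ J, PhotonSurfaces.ClassS.angularMomentum ζ s = ℓ) ∧ 0 < ℓ ∧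
        S.HasUmbilicityFactor H (|E| / ℓ) ∧
        (PhotonSurfaces.ClassS.IsFutureDirected ζ J → S.HasUmbilicityFactor H (E / ℓ))) := by
  obtain ⟨ρ, T, h, rfl⟩ := PhotonSurfaces.exists_profile hH hconn hsym htime
  have hiff := h.isPhotonSurface_iff hn
  refine ⟨hiff, ⟨fun hmax => ⟨hiff.2 hmax.1.isPhotonSurface, fun ζ J hgen =>
    hmax.isMaximalGeodesic hn hgen⟩, ?_⟩, ⟨fun hmax => ?_, ?_⟩, fun ζ J hgen =>
    h.exists_umbilicityFactor hn hgen⟩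
  · rintro ⟨⟨ζ, J, hgen⟩, hall⟩
    exact h.isMaximalPhotonSurface hn hgen (hall ζ J hgen)
  · obtain ⟨ζ, J, hgen⟩ := hiff.2 hmax.1.isPhotonSurface
    exact ⟨ζ, J, hgen, hmax.isMaximalGeodesic hn hgen⟩
  · rintro ⟨ζ, J, hgen, hmax⟩
    exact h.isMaximalPhotonSurface hn hgen hmax
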